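/- Let $\tau$ be a coordinate, $\theta=\tau^{-1}$, $R=\mathbb{C}[\tau,\tau^{-1}]=\mathbb{C}[\theta,\theta^{-1}]$. Consider pairs $(G,G_0)$ as follows. $G$ is a free $R$-module of finite rank with a connection, i.e. a $\mathbb{C}$-linear operator $\partial_\tau$ satisfying the Leibniz rule, and its singularity at $\tau=0$ is regular with quasi-unipotent monodromy (that is: some $\mathbb{C}[\tau]$-submodule $L$ of finite type, stable under $\tau\partial_\tau$, generates $G$ over $R$, and the endomorphism of $L/\tau L$ induced by $\tau\partial_\tau$ has only rational eigenvalues). $G_0$ is a lattice of $G$: a free $\mathbb{C}[\theta]$-submodule which generates $G$ over $R$ and is stable under $t=\theta^2\partial_\theta=-\partial_\tau$. Put $G_k=\theta^{-k}G_0$ for $k\in\mathbb{Z}$. Let $V_\bullet G$ be the increasing Malgrange–Kashiwara filtration of $G$ at $\tau=0$, indexed by $\mathbb{Q}$, for which $\tau\partial_\tau+\beta$ is nilpotent on $V_\beta G/V_{<\beta}G$, and put, for $\beta\in\mathbb{Q}$, $$\nu_\beta(G,G_0)=\dim_{\mathbb{C}}\ \frac{V_\beta G\cap G_0}{V_\beta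 G\cap G_{-1}+V_{<\beta}G\cap G_0}.$$ The spectrum of $(G,G_0)$ is the set of pairs $(\beta,\nu_\beta(G,G_0))$ with $\nu_\beta(G,G_0)\neq0$. Let $G^*=\mathrm{Hom}_R(G,R)$, with $(\partial_\tau\varphi)(g)=\partial_\tau(\varphi(g))-\varphi(\partial_\tau g)$, and let $G_0^*=\{\varphi\in G^*:\varphi(G_0)\subset\mathbb{C}[\theta]\}=\mathrm{Hom}_{\mathbb{C}[\theta]}(G_0,\mathbb{C}[\theta])$. Let $(\overline{G^*},\overline{G_0^*})$ be the same pair with $\tau,\partial_\tau$ acting as $-\tau,-\partial_\tau$. **Proposition.** Let $(G',G'_0)$ and $(G'',G''_0)$ be two such pairs. Assume that for some $w',w''\in\mathbb{Z}$ there are isomorphisms, compatible with the actions of $\tau$ and $\partial_\tau$ and sending the first lattice onto the second, $$(\overline{G'^*},\overline{G'^*_0})\xrightarrow{\ \sim\ }(G',G'_{w'}),\qquad(\overline{G''^*},\overline{G''^*_0})\xrightarrow{\ \sim\ }(G'',G''_{w''}).$$ Let $G=G'\otimes_R G''$, with $\partial_\tau(x\otimes y)=\partial_\tau x\otimes y+x\otimes\partial_\tau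 y$, and let $G_0=G'_0\otimes_{\mathbb{C}[\theta]}G''_0\subset G$. Then $G$ is regular at $\tau=0$ with quasi-unipotent monodromy, $G_0$ is a lattice in $G$, and the spectrum of $(G,G_0)$ is the convolution of the two spectra: for every $\beta\in\mathbb{Q}$, $$\nu_\beta(G,G_0)=\sum_{\beta'+\beta''=\beta}\nu_{\beta'}(G',G'_0)\,\nu_{\beta''}(G'',G''_0),$$ where only finitely many terms of the sum are nonzero. -/

import Mathlib

open scoped TensorProduct

noncomputable section

namespace MeroConn

/-- The ring `ℂ[τ, τ⁻¹]`. The variable `T` of Mathlib's Laurent polynomials is `τ`, and `θ = τ⁻¹`. -/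
abbrev Laurent : Type := LaurentPolynomial ℂ

/-- The coordinate `τ`. -/
def tau : Laurent := LaurentPolynomial.T 1

/-- The coordinate `θ = τ⁻¹`. -/
def theta : Laurent := LaurentPolynomial.T (-1)

/-- The subring `ℂ[τ]` of `ℂ[τ, τ⁻¹]`. -/
abbrev PolyTau : Subalgebra ℂ Laurent := Algebra.adjoin ℂ {tau}

/-- The subring `ℂ[θ]` of `ℂ[τ, τ⁻¹] = ℂ[θ, θ⁻¹]`. -/
abbrev PolyTheta : Subalgebra ℂ Laurent := Algebra.adjoin ℂ {theta}

/-- The derivation `d/dτ` of `ℂ[τ, τ⁻¹]` as a linear map: `a τⁿ ↦ n a τⁿ⁻¹`. -/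
def ddtau : Laurent →ₗ[ℂ] Laurent :=
  (Finsupp.lsum ℂ fun n : ℤ =>
    LinearMap.toSpanSingleton ℂ Laurent ((n : ℂ) • LaurentPolynomial.T (n - 1))) ∘ₗ
    (AddMonoidAlgebra.coeffLinearEquiv ℂ).toLinearMap

theorem ddtau_T (n : ℤ) :
    ddtau (LaurentPolynomial.T n) = (n : ℂ) • LaurentPolynomial.T (n - 1) := by
  unfold ddtau LaurentPolynomial.T
  change (Finsupp.lsum ℂ _) (Finsupp.single n (1 : ℂ)) = _
  rw [Finsupp.lsum_single, LinearMap.toSpanSingleton_apply, one_smul]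

/-- The Leibniz rule for `d/dτ` on `ℂ[τ, τ⁻¹]`. -/
theorem ddtau_mul (f g : Laurent) : ddtau (f * g) = ddtau f * g + f * ddtau g := by
  have hC : ∀ (a : ℂ) (n : ℤ), (LaurentPolynomial.C a * LaurentPolynomial.T n : Laurent) =
      a • LaurentPolynomial.T n := fun a n => (LaurentPolynomial.smul_eq_C_mul a _).symm
  induction f using LaurentPolynomial.induction_on' with
  | add p q hp hq => rw [add_mul, map_add, hp, hq, map_add]; ring
  | C_mul_T n a =>
    induction g using LaurentPolynomial.induction_on' with
    | add p q hp hq => rw [mul_add, map_add, hp, hq, map_add]; ring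
    | C_mul_T m b =>
      simp only [hC, smul_mul_smul_comm, ← LaurentPolynomial.T_add, map_smul, ddtau_T,
        smul_smul, Int.cast_add]
      rw [show n - 1 + m = n + m - 1 by ring, show n + (m - 1) = n + m - 1 by ring, ← add_smul]
      congr 1
      ring

/-- A connection on a `ℂ[τ, τ⁻¹]`-module `G`: a `ℂ`-linear action of `∂_τ` satisfying the Leibniz
rule, i.e. the structure of a left `ℂ[τ, τ⁻¹]⟨∂_τ⟩`-module on `G`. -/
structure Connection (G : Type*) [AddCommGroup G] [Module ℂ G] [Module Laurent G]
    [IsScalarTower ℂ Laurent G] where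
  /-- the action of `∂_τ` -/
  d : G →ₗ[ℂ] G
  leibniz : ∀ (f : Laurent) (g : G), d (f • g) = ddtau f • g + f • d g

section Basic

variable {G : Type*} [AddCommGroup G] [Module ℂ G] [Module Laurent G] [IsScalarTower ℂ Laurent G]

/-- The operator `τ∂_τ`. -/
def Connection.tauD (D : Connection G) : G →ₗ[ℂ] G where
  toFun g := tau • D.d g
  map_add' x y := by rw [map_add, smul_add]
  map_smul' c x := by rw [map_smul, smul_comm, RingHom.id_apply]

/-- The operator `t = θ²∂_θ`. Since `τ = 1/θ`, one has `θ²∂_θ = -∂_τ`. -/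
def Connection.t (D : Connection G) : G →ₗ[ℂ] G := -D.d

/-! ### Lattices (of type 1 at infinity) -/

/-- `G₀` is a lattice of `G` of type 1 at infinity: a free `ℂ[θ]`-submodule which generates `G` over
`ℂ[θ, θ⁻¹]` and is stable under `t = θ²∂_θ`. (As `θ` acts bijectively on `G`, the natural map
`ℂ[θ, θ⁻¹] ⊗ G₀ → G` is always injective, so generation means that it is bijective.) -/
structure Connection.IsLattice (D : Connection G) (G₀ : Submodule PolyTheta G) : Prop where
  free : Module.Free PolyTheta G₀
  span_eq_top : Submodule.span Laurent (G₀ : Set G) = ⊤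
  t_mem : ∀ g ∈ G₀, D.t g ∈ G₀

/-- The filtration `G_k = θ⁻ᵏ G₀ = τᵏ G₀`. -/
def latticeShift (G₀ : Submodule PolyTheta G) (k : ℤ) : Submodule PolyTheta G :=
  G₀.map ((LinearMap.lsmul Laurent G (LaurentPolynomial.T k)).restrictScalars PolyTheta)

/-! ### Regularity and quasi-unipotence at `τ = 0` -/

/-- `L` is a logarithmic lattice at `τ = 0`: a `ℂ[τ]`-submodule of finite type which generates `G`
over `ℂ[τ, τ⁻¹]` and is stable under `τ∂_τ`. -/
structure Connection.IsLogLattice (D : Connection G) (L : Submodule PolyTau G) : Prop where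
  fg : L.FG
  span_eq_top : Submodule.span Laurent (L : Set G) = ⊤
  tauD_mem : ∀ g ∈ L, D.tauD g ∈ L

/-- The eigenvalues of the residue of the logarithmic lattice `L`, that is of the endomorphism of
`L / τL` induced by `τ∂_τ`: the eigenvector is the class of an element `g` of `L` not in `τL`. -/
def Connection.IsResidueEigenvalue (D : Connection G) (L : Submodule PolyTau G) (c : ℂ) : Prop :=
  ∃ g ∈ L, (¬ ∃ h ∈ L, g = tau • h) ∧ ∃ h ∈ L, D.tauD g - c • g = tau • h

/-- `G` has a regular singularity at `τ = 0` with quasi-unipotent monodromy: there is a logarithmic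
lattice whose residue has only rational eigenvalues. (The eigenvalues of the monodromy around
`τ = 0` are the numbers `exp (-2πi c)` with `c` an eigenvalue of the residue.) -/
def Connection.IsRegularQuasiUnipotent (D : Connection G) : Prop :=
  ∃ L : Submodule PolyTau G, D.IsLogLattice L ∧
    ∀ c : ℂ, D.IsResidueEigenvalue L c → ∃ q : ℚ, c = (q : ℂ)

/-! ### The Malgrange-Kashiwara filtration at `τ = 0` -/

/-- `V_{<β} = ⋃_{γ<β} V_γ` for an increasing filtration `V` indexed by `ℚ`. -/
def VLt (V : ℚ → Submodule PolyTau G) (β : ℚ) : Submodule PolyTau G :=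
  ⨆ γ : Set.Iio β, V γ

/-- The characteristic properties of the Malgrange-Kashiwara filtration of `G` at `τ = 0`. It is
written as a filtration indexed by all of `ℚ`, with jumps in finitely many classes `a + ℤ`.
With `V_{-1}D = τ ℂ[τ]⟨τ∂_τ⟩`, `V_0 D = ℂ[τ]⟨τ∂_τ⟩` and `V_1 D = V_0 D + ∂_τ V_0 D`, the fields
`tau_mem`, `d_mem`, `finite_type`, `tau_generates` and `d_generates` say that each `V_{α+ℤ}` is a
good filtration relatively to the filtration `V_• D` of `D = ℂ[τ]⟨∂_τ⟩`. -/
structure Connection.IsVFiltration (D : Connection G) (V : ℚ → Submodule PolyTau G) : Prop where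
  mono : Monotone V
  jumps : ∃ A : Finset ℚ, ∀ β γ : ℚ, γ ≤ β →
    (∀ a ∈ A, ∀ k : ℤ, ¬ (γ < a + k ∧ a + k ≤ β)) → V γ = V β
  exhaustive : ∀ g : G, ∃ β : ℚ, g ∈ V β
  tau_mem : ∀ β : ℚ, ∀ g ∈ V β, tau • g ∈ V (β - 1)
  d_mem : ∀ β : ℚ, ∀ g ∈ V β, D.d g ∈ V (β + 1)
  /-- each `V_β` is of finite type over `ℂ[τ]⟨τ∂_τ⟩` -/
  finite_type : ∀ β : ℚ, ∃ S : Finset G, (S : Set G) ⊆ V β ∧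
    ∀ W : Submodule PolyTau G, (S : Set G) ⊆ W → (∀ g ∈ W, D.tauD g ∈ W) → V β ≤ W
  /-- `V_{α+k-1} = τ V_{α+k}` for `k ≪ 0` -/
  tau_generates : ∀ α : ℚ, ∃ k₀ : ℤ, ∀ k : ℤ, k ≤ k₀ →
    ∀ g ∈ V (α + k - 1), ∃ h ∈ V (α + k), g = tau • h
  /-- `V_{α+k+1} = V_{α+k} + ∂_τ V_{α+k}` for `k ≫ 0` -/
  d_generates : ∀ α : ℚ, ∃ k₀ : ℤ, ∀ k : ℤ, k₀ ≤ k →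
    ∀ g ∈ V (α + k + 1), ∃ u ∈ V (α + k), ∃ v ∈ V (α + k), g = u + D.d v
  /-- `τ∂_τ + β` is nilpotent on `gr_β V = V_β / V_{<β}` -/
  nilpotent : ∀ β : ℚ, ∃ N : ℕ, ∀ g ∈ V β,
    ((D.tauD + (β : ℂ) • LinearMap.id : Module.End ℂ G) ^ N) g ∈ VLt V β

open Classical in
/-- The Malgrange-Kashiwara filtration `V_• G` of `G` at `τ = 0`, the unique filtration with the
characteristic properties. It exists when `G` is regular with quasi-unipotent monodromy at `0`; the
value when there is no such filtration is irrelevant. -/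
def Connection.vFiltration (D : Connection G) : ℚ → Submodule PolyTau G :=
  if h : ∃ V, D.IsVFiltration V then h.choose else fun _ => ⊥

/-! ### The spectrum -/

/-- The number `ν_β(G, G₀) = dim (V_β ∩ G₀) / (V_β ∩ G_{-1} + V_{<β} ∩ G₀)`. The spectrum of
`(G, G₀)` is the set of pairs `(β, ν_β)` with `ν_β ≠ 0`. -/
def Connection.nu (D : Connection G) (G₀ : Submodule PolyTheta G) (β : ℚ) : ℕ :=
  let Vβ : Submodule ℂ G := (D.vFiltration β).restrictScalars ℂ
  let Vlt : Submodule ℂ G := (VLt D.vFiltration β).restrictScalars ℂ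
  let L : Submodule ℂ G := G₀.restrictScalars ℂ
  let L₁ : Submodule ℂ G := (latticeShift G₀ (-1)).restrictScalars ℂ
  Module.finrank ℂ (↥(Vβ ⊓ L) ⧸ ((Vβ ⊓ L₁) ⊔ (Vlt ⊓ L)).submoduleOf (Vβ ⊓ L))

/-! ### Duality -/

/-- The connection on `G* = Hom(G, ℂ[τ, τ⁻¹])`: `(∂_τ φ)(g) = ∂_τ(φ(g)) - φ(∂_τ g)`. -/
def Connection.dual (D : Connection G) : Connection (Module.Dual Laurent G) where
  d :=
    { toFun := fun φ =>
        { toFun := fun g => ddtau (φ g) - φ (D.d g)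
          map_add' := fun x y => by simp only [map_add, add_sub_add_comm]
          map_smul' := fun f x => by
            simp only [D.leibniz, map_smul, map_add, smul_eq_mul, ddtau_mul, RingHom.id_apply]
            ring }
      map_add' := fun φ ψ => by
        ext g
        simp only [LinearMap.coe_mk, AddHom.coe_mk, LinearMap.add_apply, map_add,
          add_sub_add_comm]
      map_smul' := fun c φ => by
        ext g : 1
        simp only [LinearMap.coe_mk, AddHom.coe_mk, LinearMap.smul_apply, map_smul,
          RingHom.id_apply, smul_sub] }
  leibniz := fun f φ => by
    ext g : 1
    simp only [LinearMap.coe_mk, AddHom.coe_mk, LinearMap.smul_apply, LinearMap.add_apply,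
      smul_eq_mul, ddtau_mul]
    ring

/-- The lattice `G*₀ = Hom_{ℂ[θ]}(G₀, ℂ[θ])`, seen in `G*` as `{φ | φ(G₀) ⊆ ℂ[θ]}`. -/
def dualLattice (G₀ : Submodule PolyTheta G) : Submodule PolyTheta (Module.Dual Laurent G) where
  carrier := {φ | ∀ g ∈ G₀, φ g ∈ PolyTheta}
  add_mem' := fun ha hb g hg => add_mem (ha g hg) (hb g hg)
  zero_mem' := fun _ _ => zero_mem _
  smul_mem' := fun c _ ha g hg => mul_mem c.2 (ha g hg)

/-- There is an isomorphism from the conjugate `(G̅*, G̅*₀)` of `(G*, G*₀)` onto `(G, G_w)`, where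
`τ` and `∂_τ` act on the conjugate as `-τ` and `-∂_τ` do on `G*`. -/
def Connection.IsSelfDual (D : Connection G) (G₀ : Submodule PolyTheta G) (w : ℤ) : Prop :=
  ∃ Φ : Module.Dual Laurent G ≃ₗ[ℂ] G,
    (∀ φ, Φ (-(tau • φ)) = tau • Φ φ) ∧
    (∀ φ, Φ (-(D.dual.d φ)) = D.d (Φ φ)) ∧
    (∀ φ, φ ∈ dualLattice G₀ ↔ Φ φ ∈ latticeShift G₀ w)

end Basic

/-! ### Tensor products -/

section Tensor

variable {G₁ G₂ : Type*}
  [AddCommGroup G₁] [Module ℂ G₁] [Module Laurent G₁] [IsScalarTower ℂ Laurent G₁]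
  [AddCommGroup G₂] [Module ℂ G₂] [Module Laurent G₂] [IsScalarTower ℂ Laurent G₂]

/-- The action of `∂_τ` on `G₁ ⊗ G₂`: `∂_τ(x ⊗ y) = ∂_τ x ⊗ y + x ⊗ ∂_τ y`. -/
def tensorD (D₁ : Connection G₁) (D₂ : Connection G₂) :
    G₁ ⊗[Laurent] G₂ →+ G₁ ⊗[Laurent] G₂ :=
  TensorProduct.liftAddHom
    { toFun := fun x =>
        { toFun := fun y => D₁.d x ⊗ₜ[Laurent] y + x ⊗ₜ[Laurent] D₂.d y
          map_zero' := by simp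
          map_add' := fun y z => by
            simp only [map_add, TensorProduct.tmul_add]
            rw [add_add_add_comm] }
      map_zero' := by ext; simp
      map_add' := fun x y => by
        ext z
        simp only [map_add, TensorProduct.add_tmul, AddMonoidHom.coe_mk, ZeroHom.coe_mk,
          AddMonoidHom.add_apply]
        rw [add_add_add_comm] }
    (fun f x y => by
      simp only [AddMonoidHom.coe_mk, ZeroHom.coe_mk, Connection.leibniz, TensorProduct.add_tmul,
        TensorProduct.tmul_add, TensorProduct.smul_tmul, TensorProduct.tmul_smul]
      rw [add_assoc, add_left_comm])

theorem tensorD_tmul (D₁ : Connection G₁) (D₂ : Connection G₂) (x : G₁) (y : G₂) :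
    tensorD D₁ D₂ (x ⊗ₜ[Laurent] y) = D₁.d x ⊗ₜ[Laurent] y + x ⊗ₜ[Laurent] D₂.d y := rfl

theorem tensorD_smul (D₁ : Connection G₁) (D₂ : Connection G₂) (f : Laurent)
    (z : G₁ ⊗[Laurent] G₂) :
    tensorD D₁ D₂ (f • z) = ddtau f • z + f • tensorD D₁ D₂ z := by
  induction z with
  | zero => simp
  | add x y hx hy => rw [smul_add, map_add, hx, hy, map_add, smul_add, smul_add]; abel
  | tmul x y =>
    rw [TensorProduct.smul_tmul', tensorD_tmul, tensorD_tmul, D₁.leibniz, TensorProduct.add_tmul,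
      smul_add, TensorProduct.smul_tmul', TensorProduct.smul_tmul', TensorProduct.smul_tmul',
      add_assoc]

/-- The tensor product of two connections. -/
def Connection.tensor (D₁ : Connection G₁) (D₂ : Connection G₂) :
    Connection (G₁ ⊗[Laurent] G₂) where
  d :=
    { toFun := tensorD D₁ D₂
      map_add' := map_add _
      map_smul' := fun c z => by
        have h : ddtau (algebraMap ℂ Laurent c) = 0 := by
          rw [Algebra.algebraMap_eq_smul_one, map_smul, ← LaurentPolynomial.T_zero, ddtau_T]
          simp
        have h2 := tensorD_smul D₁ D₂ (algebraMap ℂ Laurent c) z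
        rw [h, zero_smul, zero_add, algebraMap_smul, algebraMap_smul] at h2
        exact h2 }
  leibniz := tensorD_smul D₁ D₂

/-- The lattice `G₀ = L₁ ⊗_{ℂ[θ]} L₂`, seen in `G₁ ⊗ G₂` as the `ℂ[θ]`-submodule generated by the
products `x ⊗ y` with `x ∈ L₁`, `y ∈ L₂`. -/
def tensorLattice (L₁ : Submodule PolyTheta G₁) (L₂ : Submodule PolyTheta G₂) :
    Submodule PolyTheta (G₁ ⊗[Laurent] G₂) :=
  Submodule.span PolyTheta {z | ∃ x ∈ L₁, ∃ y ∈ L₂, z = x ⊗ₜ[Laurent] y}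

end Tensor

end MeroConn

end

open MeroConn

open MeroConn
open scoped TensorProduct

set_option linter.unusedSectionVars false

/-! Each pair has a basis `eᵢ` over `ℂ[τ, τ⁻¹]` with rational weights `aᵢ` such that `V_β` is
spanned over `ℂ` by the `τᵐ eᵢ` with `aᵢ - m ≤ β`, and `G₀ = ⨁ ℂ[θ] eᵢ` (`IsSplitBy`). This is a
Birkhoff-Grothendieck splitting in which a `ℂ[θ]`-lattice faces a whole filtration by
`ℂ[τ]`-lattices. In such a basis `V_β`, `V_{<β}`, `G₀` and `G_{-1}` are all spanned by monomials,
and the quotient defining `ν_β` has the `eᵢ` with `aᵢ = β` as a basis: the spectrum is the multiset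
of weights (`IsSplitBy.nu_eq`).

The products of the two bases, with the sums of weights, split the tensor lattice and define a
filtration of `G' ⊗ G''`. On its graded pieces `τ∂_τ + β' + β''` acts as a sum of two commuting
nilpotent operators, so by uniqueness this is the Malgrange-Kashiwara filtration. Counting pairs of
basis vectors gives the convolution.

The splitting is `exists_adapted_basis`: representatives of bases of `(V_β ∩ G₀) / (V_β ∩ G_{-1} +
V_{<β} ∩ G₀)`, taken for all `β`, generate by induction on `β`, because `V_β ∩ G₀ = 0` for `β ≪ 0`;
they are independent because they are so modulo `θG₀`.

Existence and uniqueness of the filtration rest on one remark: a vector sent into a stable subspace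
by two polynomials in `τ∂_τ` without common root already lies in it. Thus `V_β` collects the vectors
on which `τ∂_τ` has, modulo high powers of `τ`, only eigenvalues `-γ` with `γ ≤ β`. -/

namespace MeroConn

open Polynomial LaurentPolynomial

/-! ### Polynomials in `τ∂_τ` and their commutation with powers of `τ` -/

section Operators

variable {G : Type*} [AddCommGroup G] [Module ℂ G] [Module Laurent G] [IsScalarTower ℂ Laurent G]

theorem T_smul_T_smul (m n : ℤ) (g : G) :
    (T m : Laurent) • (T n : Laurent) • g = (T (m + n) : Laurent) • g := by
  rw [smul_smul, T_add]

theorem T_neg_smul_T_smul (n : ℤ) (g : G) : (T (-n) : Laurent) • (T n : Laurent) • g = g := by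
  rw [T_smul_T_smul, neg_add_cancel, T_zero, one_smul]

theorem T_smul_T_neg_smul (n : ℤ) (g : G) : (T n : Laurent) • (T (-n) : Laurent) • g = g := by
  rw [T_smul_T_smul, add_neg_cancel, T_zero, one_smul]

theorem Connection.tauD_apply (D : Connection G) (g : G) : D.tauD g = tau • D.d g := rfl

theorem Connection.d_eq_T_smul_tauD (D : Connection G) (g : G) :
    D.d g = (T (-1) : Laurent) • D.tauD g := by
  rw [D.tauD_apply, tau, T_neg_smul_T_smul]

/-- Since `τ∂_τ(τⁿ) = nτⁿ`, multiplication by `τⁿ` translates the eigenvalues of `τ∂_τ` by `n`,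
which is why it lowers the index of `V` by `n`. -/
theorem Connection.tauD_T_smul (D : Connection G) (n : ℤ) (g : G) :
    D.tauD ((T n : Laurent) • g) = (T n : Laurent) • (D.tauD g + (n : ℂ) • g) := by
  rw [D.tauD_apply, D.leibniz, ddtau_T, smul_add, smul_add, tau, D.tauD_apply, tau,
    T_smul_T_smul, T_smul_T_smul, smul_assoc, smul_comm (T 1 : Laurent) (n : ℂ), T_smul_T_smul,
    smul_comm (T n : Laurent) (n : ℂ), add_comm, add_comm 1 n]
  congr 4
  ring

theorem Connection.aeval_tauD_T_smul (D : Connection G) (P : ℂ[X]) (n : ℤ) (g : G) :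
    aeval D.tauD P ((T n : Laurent) • g) =
      (T n : Laurent) • aeval D.tauD (P.comp (X + Polynomial.C (n : ℂ))) g := by
  induction P using Polynomial.induction_on generalizing g with
  | C a =>
    rw [C_comp, aeval_C, Module.algebraMap_end_apply, Module.algebraMap_end_apply, smul_comm]
  | add p q hp hq => simp [hp, hq, smul_add]
  | monomial k a h =>
    have e : Polynomial.C a * X ^ (k + 1) = (Polynomial.C a * X ^ k) * X := by ring
    rw [e, map_mul, Module.End.mul_apply, aeval_X, D.tauD_T_smul, h, mul_comp (_ * _), map_mul,
      Module.End.mul_apply, X_comp,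
      map_add (aeval (R := ℂ) D.tauD), aeval_X, aeval_C, LinearMap.add_apply,
      Module.algebraMap_end_apply]

theorem aeval_apply_mem {E : Module.End ℂ G} {M : Submodule ℂ G} (hM : ∀ g ∈ M, E g ∈ M)
    (P : ℂ[X]) {g : G} (hg : g ∈ M) : aeval E P g ∈ M := by
  induction P using Polynomial.induction_on generalizing g with
  | C a => simpa using M.smul_mem a hg
  | add p q hp hq => simpa using M.add_mem (hp hg) (hq hg)
  | monomial k a h =>
    have e : Polynomial.C a * X ^ (k + 1) = (Polynomial.C a * X ^ k) * X := by ring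
    rw [e, map_mul, Module.End.mul_apply, aeval_X]
    exact h (hM g hg)

theorem aeval_mul_apply_mem {E : Module.End ℂ G} {M : Submodule ℂ G} (hM : ∀ g ∈ M, E g ∈ M)
    {P : ℂ[X]} (Q : ℂ[X]) {g : G} (hg : aeval E P g ∈ M) : aeval E (P * Q) g ∈ M := by
  rw [mul_comm, map_mul, Module.End.mul_apply]
  exact aeval_apply_mem hM Q hg

/-- If two polynomials in `E` send `g` into the stable submodule `M`, so does a polynomial all
whose roots are common roots. -/
theorem exists_aeval_apply_mem_of_common_roots {E : Module.End ℂ G} {M : Submodule ℂ G}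
    (hM : ∀ g ∈ M, E g ∈ M) {P Q : ℂ[X]} {g : G} (hP : aeval E P g ∈ M) (hQ : aeval E Q g ∈ M) :
    ∃ R : ℂ[X], aeval E R g ∈ M ∧ ∀ x, R.eval x = 0 → P.eval x = 0 ∧ Q.eval x = 0 := by
  classical
  refine ⟨EuclideanDomain.gcd P Q, ?_, fun x hx => ⟨?_, ?_⟩⟩
  · rw [EuclideanDomain.gcd_eq_gcd_ab, map_add, LinearMap.add_apply]
    exact M.add_mem (aeval_mul_apply_mem hM _ hP) (aeval_mul_apply_mem hM _ hQ)
  · exact eval_eq_zero_of_dvd_of_eval_eq_zero (EuclideanDomain.gcd_dvd_left P Q) hx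
  · exact eval_eq_zero_of_dvd_of_eval_eq_zero (EuclideanDomain.gcd_dvd_right P Q) hx

/-- Over `ℂ` a polynomial without roots is a nonzero constant, so the Bézout combination of `P` and
`Q` is invertible. Memberships are deduced from eigenvalues in this way throughout. -/
theorem mem_of_aeval_apply_mem_of_no_common_root {E : Module.End ℂ G} {M : Submodule ℂ G}
    (hM : ∀ g ∈ M, E g ∈ M) {P Q : ℂ[X]} {g : G} (hP : aeval E P g ∈ M) (hQ : aeval E Q g ∈ M)
    (h : ∀ x, P.eval x = 0 → Q.eval x ≠ 0) : g ∈ M := by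
  obtain ⟨R, hR, hx⟩ := exists_aeval_apply_mem_of_common_roots hM hP hQ
  have hdeg : R.degree = 0 := by
    by_contra hd
    obtain ⟨x, h0⟩ := IsAlgClosed.exists_root R hd
    exact h x (hx x h0).1 (hx x h0).2
  rw [Polynomial.eq_C_of_degree_eq_zero hdeg] at hR
  have hc : R.coeff 0 ≠ 0 := fun h0 => by
    rw [Polynomial.eq_C_of_degree_eq_zero hdeg, h0] at hdeg
    simp at hdeg
  simpa [Submodule.smul_mem_iff _ hc] using hR

/-- A `ℂ`-subspace stable under `f`, as a `ℂ[f]`-submodule. -/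
def adjoinSubmodule {f : Laurent} (M : Submodule ℂ G) (h : ∀ g ∈ M, f • g ∈ M) :
    Submodule (Algebra.adjoin ℂ {f} : Subalgebra ℂ Laurent) G where
  carrier := M
  add_mem' := M.add_mem
  zero_mem' := M.zero_mem
  smul_mem' := by
    rintro ⟨p, hf⟩ g hg
    change p • g ∈ M
    induction hf using Algebra.adjoin_induction generalizing g with
    | mem x hx => rw [Set.mem_singleton_iff.1 hx]; exact h g hg
    | algebraMap r => rw [algebraMap_smul]; exact M.smul_mem r hg
    | add x y _ _ hx hy => rw [add_smul]; exact M.add_mem (hx hg) (hy hg)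
    | mul x y _ _ hx hy => rw [mul_smul]; exact hx (hy hg)

@[simp]
theorem mem_adjoinSubmodule {f : Laurent} {M : Submodule ℂ G} {h : ∀ g ∈ M, f • g ∈ M} {g : G} :
    g ∈ adjoinSubmodule M h ↔ g ∈ M := Iff.rfl

theorem T_mem_polyTau (n : ℕ) : (T n : Laurent) ∈ PolyTau := by
  have := PolyTau.pow_mem (Algebra.self_mem_adjoin_singleton ℂ tau) n
  rwa [tau, T_pow, mul_one] at this

theorem T_mem_polyTheta (n : ℕ) : (T (-n) : Laurent) ∈ PolyTheta := by
  have := PolyTheta.pow_mem (Algebra.self_mem_adjoin_singleton ℂ theta) n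
  rw [theta, T_pow] at this
  convert this using 2
  ring

theorem T_smul_mem_of_polyTau (L : Submodule PolyTau G) {n : ℤ} (hn : 0 ≤ n) {g : G}
    (hg : g ∈ L) : (T n : Laurent) • g ∈ L := by
  lift n to ℕ using hn
  exact L.smul_mem ⟨_, T_mem_polyTau n⟩ hg

theorem T_smul_mem_of_polyTheta (L : Submodule PolyTheta G) {n : ℤ} (hn : n ≤ 0) {g : G}
    (hg : g ∈ L) : (T n : Laurent) • g ∈ L := by
  obtain ⟨m, rfl⟩ : ∃ m : ℕ, n = -m := ⟨n.natAbs, by omega⟩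
  exact L.smul_mem ⟨_, T_mem_polyTheta m⟩ hg

theorem complex_smul_mem_of_subalgebra {A : Subalgebra ℂ Laurent} (L : Submodule A G) (c : ℂ)
    {g : G} (hg : g ∈ L) : c • g ∈ L :=
  (L.restrictScalars ℂ).smul_mem c hg

/-- Provides finite generation of any `ℂ[τ]`-submodule enclosed in a translate of a lattice. -/
instance isNoetherianRing_polyTau : IsNoetherianRing PolyTau := by
  refine isNoetherianRing_of_fg ⟨{tau}, ?_⟩
  rw [Finset.coe_singleton]

end Operators

end MeroConn

namespace MeroConn

open Polynomial LaurentPolynomial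

/-! ### Logarithmic filtrations and uniqueness of the Malgrange-Kashiwara filtration -/

section Filtrations

variable {G : Type*} [AddCommGroup G] [Module ℂ G] [Module Laurent G] [IsScalarTower ℂ Laurent G]

theorem VLt_le {V : ℚ → Submodule PolyTau G} {β : ℚ} {W : Submodule PolyTau G}
    (h : ∀ γ < β, V γ ≤ W) : VLt V β ≤ W :=
  iSup_le fun γ => h γ γ.2

theorem le_VLt (V : ℚ → Submodule PolyTau G) {γ β : ℚ} (h : γ < β) : V γ ≤ VLt V β :=
  le_iSup (fun γ : Set.Iio β => V γ) ⟨γ, h⟩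

theorem VLt_le_of_floor {V : ℚ → Submodule PolyTau G} (mono : Monotone V) {N : ℕ} (hN : 0 < N)
    (jumps : ∀ β : ℚ, V β = V (⌊N * β⌋ / N)) (n : ℤ) : VLt V (n / N) ≤ V ((n - 1 : ℤ) / N) := by
  have hN' : (0 : ℚ) < N := by exact_mod_cast hN
  refine VLt_le fun γ hγ => ?_
  rw [jumps γ]
  refine mono (div_le_div_of_nonneg_right ?_ hN'.le)
  have : ⌊(N : ℚ) * γ⌋ < n := Int.floor_lt.2 (by rw [mul_comm]; exact (lt_div_iff₀ hN').1 hγ)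
  exact_mod_cast Int.le_sub_one_of_lt this

theorem Connection.aeval_X_add_C_pow (D : Connection G) (β : ℚ) (M : ℕ) :
    aeval D.tauD ((X + Polynomial.C (β : ℂ)) ^ M) =
      ((D.tauD + (β : ℂ) • LinearMap.id : Module.End ℂ G) ^ M) := by
  rw [map_pow, map_add, aeval_X, aeval_C]
  rfl

/-- Elements of `V_β` are sent into `V_{β₀}` by a polynomial in `τ∂_τ` with roots in
`[-β, -β₀)`. -/
theorem Connection.exists_aeval_mem_of_nilpotent (D : Connection G)
    {V : ℚ → Submodule PolyTau G} (mono : Monotone V) {N : ℕ} (hN : 0 < N)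
    (jumps : ∀ β : ℚ, V β = V (⌊N * β⌋ / N))
    (nilpotent : ∀ β : ℚ, ∃ M : ℕ, ∀ g ∈ V β,
      ((D.tauD + (β : ℂ) • LinearMap.id : Module.End ℂ G) ^ M) g ∈ VLt V β)
    {β₀ β : ℚ} (h : β₀ ≤ β) : ∃ P : ℂ[X], (∀ g ∈ V β, aeval D.tauD P g ∈ V β₀) ∧
      ∀ x, P.eval x = 0 → ∃ γ : ℚ, β₀ < γ ∧ γ ≤ β ∧ x = -(γ : ℂ) := by
  have hN' : (0 : ℚ) < N := by exact_mod_cast hN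
  -- Descend one jump at a time: each step from `j / N` to `(j - 1) / N` contributes a power of `X +
  -- j / N`.
  have key : ∀ (n : ℤ) (d : ℕ), ∃ P : ℂ[X],
      (∀ g ∈ V ((n + d : ℤ) / N), aeval D.tauD P g ∈ V (n / N)) ∧
      ∀ x, P.eval x = 0 → ∃ j : ℤ, n < j ∧ j ≤ n + d ∧ x = -((j / N : ℚ) : ℂ) := by
    intro n d
    induction d with
    | zero => exact ⟨1, by simp, by simp⟩
    | succ d ih =>
      obtain ⟨P, hP, hPx⟩ := ih
      obtain ⟨M, hM⟩ := nilpotent ((n + (d + 1 : ℕ) : ℤ) / N)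
      refine ⟨P * (X + Polynomial.C (((n + (d + 1 : ℕ) : ℤ) / N : ℚ) : ℂ)) ^ M,
        fun g hg => ?_, fun x hx => ?_⟩
      · rw [map_mul, Module.End.mul_apply, D.aeval_X_add_C_pow]
        apply hP
        have := VLt_le_of_floor mono hN jumps _ (hM g hg)
        convert this using 4
        push_cast; ring
      · rw [eval_mul, mul_eq_zero, eval_pow] at hx
        rcases hx with hx | hx
        · obtain ⟨j, h1, h2, h3⟩ := hPx x hx
          exact ⟨j, h1, by push_cast; omega, h3⟩
        · refine ⟨n + (d + 1 : ℕ), by omega, le_rfl, ?_⟩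
          have := eq_zero_of_pow_eq_zero hx
          rw [eval_add, eval_X, eval_C] at this
          exact eq_neg_of_add_eq_zero_left this
  have hfl : ⌊(N : ℚ) * β₀⌋ ≤ ⌊(N : ℚ) * β⌋ := Int.floor_mono (by gcongr)
  obtain ⟨d, hd⟩ := Int.le.dest hfl
  obtain ⟨P, hP, hPx⟩ := key ⌊(N : ℚ) * β₀⌋ d
  refine ⟨P, fun g hg => ?_, fun x hx => ?_⟩
  · rw [jumps β₀]
    apply hP
    rw [hd, ← jumps β]
    exact hg
  · obtain ⟨j, h1, h2, h3⟩ := hPx x hx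
    refine ⟨j / N, ?_, ?_, h3⟩
    · rw [lt_div_iff₀ hN', mul_comm]
      exact Int.floor_lt.1 h1
    · rw [div_le_iff₀ hN', mul_comm]
      rw [hd] at h2
      exact Int.le_floor.1 h2

/-- The filtrations by logarithmic lattices with nilpotent graded residues, with jumps in
`(1 / N) ℤ` for some `N`. -/
structure Connection.IsLogFiltration (D : Connection G) (V : ℚ → Submodule PolyTau G) : Prop where
  mono : Monotone V
  jumps : ∃ N : ℕ, 0 < N ∧ ∀ β : ℚ, V β = V (⌊N * β⌋ / N)
  exhaustive : ∀ g : G, ∃ β : ℚ, g ∈ V β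
  tau_mem_iff : ∀ (β : ℚ) (g : G), tau • g ∈ V (β - 1) ↔ g ∈ V β
  tauD_mem : ∀ (β : ℚ), ∀ g ∈ V β, D.tauD g ∈ V β
  fg : (V 0).FG
  nilpotent : ∀ β : ℚ, ∃ N : ℕ, ∀ g ∈ V β,
    ((D.tauD + (β : ℂ) • LinearMap.id : Module.End ℂ G) ^ N) g ∈ VLt V β

namespace Connection.IsLogFiltration

variable {D : Connection G} {V : ℚ → Submodule PolyTau G}

theorem T_smul_mem_iff (hV : D.IsLogFiltration V) (n : ℤ) (β : ℚ) (g : G) :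
    (T n : Laurent) • g ∈ V (β - n) ↔ g ∈ V β := by
  have hnat : ∀ (n : ℕ) (β : ℚ) (g : G), (T n : Laurent) • g ∈ V (β - n) ↔ g ∈ V β := by
    intro n
    induction n with
    | zero => intro β g; simp
    | succ n ih =>
      intro β g
      rw [← ih β g, ← hV.tau_mem_iff (β - n), tau, T_smul_T_smul]
      push_cast
      rw [sub_sub, add_comm (1 : ℤ)]
  obtain ⟨m, rfl | rfl⟩ := n.eq_nat_or_neg
  · exact_mod_cast hnat m β g
  · have := hnat m (β + m) ((T (-m) : Laurent) • g)
    rw [T_smul_T_neg_smul] at this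
    rw [add_sub_cancel_right] at this
    rw [this]
    push_cast
    rw [sub_neg_eq_add]

theorem T_smul_mem (hV : D.IsLogFiltration V) (n : ℤ) {β γ : ℚ} {g : G} (hg : g ∈ V β)
    (h : β - n ≤ γ) : (T n : Laurent) • g ∈ V γ :=
  hV.mono h ((hV.T_smul_mem_iff n β g).2 hg)

theorem fg_apply (hV : D.IsLogFiltration V) (β : ℚ) : (V β).FG := by
  obtain ⟨n, hn⟩ := exists_nat_ge β
  refine (hV.fg.map
    ((LinearMap.lsmul Laurent G (T (-n) : Laurent)).restrictScalars PolyTau)).of_le fun g hg => ?_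
  exact ⟨(T n : Laurent) • g, hV.T_smul_mem n hg (by push_cast; linarith), T_neg_smul_T_smul n g⟩

theorem exists_le_of_fg (hV : D.IsLogFiltration V) {V' : ℚ → Submodule PolyTau G}
    (mono : Monotone V') (exhaustive : ∀ g : G, ∃ β : ℚ, g ∈ V' β) : ∃ c, V 0 ≤ V' c := by
  obtain ⟨S, hS⟩ := hV.fg
  choose b hb using exhaustive
  obtain ⟨c, hc⟩ := (S.image b).bddAbove
  refine ⟨c, ?_⟩
  rw [← hS, Submodule.span_le]
  exact fun g hg => mono (hc (Finset.mem_coe.2 (Finset.mem_image_of_mem b hg))) (hb g)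

theorem isVFiltration (hV : D.IsLogFiltration V) : D.IsVFiltration V where
  mono := hV.mono
  jumps := by
    obtain ⟨N, hN, hj⟩ := hV.jumps
    have hN' : (0 : ℚ) < N := by exact_mod_cast hN
    -- If the two floors differ, `⌊Nβ⌋ / N` is a possible jump in `(γ, β]`; Euclidean division by
    -- `N` puts it in one of the classes `m / N + ℤ` with `0 ≤ m < N`.
    refine ⟨(Finset.range N).image fun m : ℕ => (m / N : ℚ), fun β γ h hA => ?_⟩
    rw [hj γ, hj β]
    by_contra hne
    have hlt : ⌊(N : ℚ) * γ⌋ < ⌊(N : ℚ) * β⌋ := by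
      refine lt_of_le_of_ne (Int.floor_mono (by gcongr)) fun h => hne (by rw [h])
    have hZ : (0 : ℤ) < N := by exact_mod_cast hN
    have hm := Int.emod_nonneg ⌊(N : ℚ) * β⌋ hZ.ne'
    have hm' := Int.emod_lt_of_pos ⌊(N : ℚ) * β⌋ hZ
    have hdiv := Int.emod_add_mul_ediv ⌊(N : ℚ) * β⌋ N
    obtain ⟨m, hmm⟩ := Int.eq_ofNat_of_zero_le hm
    have hval : ((m : ℚ) / N) + (⌊(N : ℚ) * β⌋ / (N : ℤ) : ℤ) = ⌊(N : ℚ) * β⌋ / N := by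
      rw [hmm] at hdiv
      have hdiv' : (m : ℚ) + N * (⌊(N : ℚ) * β⌋ / (N : ℤ) : ℤ) = ⌊(N : ℚ) * β⌋ := by
        exact_mod_cast hdiv
      rw [← hdiv']
      field_simp
    refine hA (m / N) (Finset.mem_image_of_mem _ (Finset.mem_range.2 (by omega)))
      (⌊(N : ℚ) * β⌋ / (N : ℤ)) ?_
    rw [hval]
    constructor
    · rw [lt_div_iff₀ hN', mul_comm]
      exact Int.floor_lt.1 hlt
    · rw [div_le_iff₀ hN', mul_comm]
      exact Int.floor_le _
  exhaustive := hV.exhaustive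
  tau_mem β g hg := (hV.tau_mem_iff β g).2 hg
  d_mem β g hg := by
    rw [D.d_eq_T_smul_tauD]
    exact hV.T_smul_mem (-1) (hV.tauD_mem β g hg) (by push_cast; linarith)
  finite_type β := by
    obtain ⟨S, hS⟩ := hV.fg_apply β
    refine ⟨S, hS ▸ Submodule.subset_span, fun W hW _ => ?_⟩
    rw [← hS]
    exact Submodule.span_le.2 hW
  tau_generates α := ⟨0, fun k _ g hg => ⟨(T (-1) : Laurent) • g,
    hV.T_smul_mem (-1) hg (by push_cast; linarith), (T_smul_T_neg_smul 1 g).symm⟩⟩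
  d_generates α := by
    -- This bound makes `α + k - 1 ≥ 0`, so every root `-γ` of the `P` below has `γ > 0`, whence
    -- `P(0) ≠ 0`.
    refine ⟨⌈1 - α⌉, fun k hk g hg => ?_⟩
    have hk' : 1 ≤ α + k := by have := Int.ceil_le.1 hk; linarith
    obtain ⟨N, hN, hj⟩ := hV.jumps
    obtain ⟨P, hP, hPx⟩ := D.exists_aeval_mem_of_nilpotent hV.mono hN hj hV.nilpotent
      (sub_le_self (α + k) zero_le_one)
    have h0 : P.eval 0 ≠ 0 := fun h => by
      obtain ⟨γ, h1, h2, h3⟩ := hPx 0 h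
      rw [eq_comm, neg_eq_zero, Rat.cast_eq_zero] at h3
      linarith
    have hg' : tau • g ∈ V (α + k) := by
      have := (hV.tau_mem_iff (α + k + 1) g).2 hg
      rwa [add_sub_cancel_right] at this
    set c := P.eval 0 with hc
    -- This is `P = X · P.divX + P(0)` solved for `τg`. After division by `τ`, the term in `P`,
    -- which lies in `V_{α+k-1}`, falls into `V_{α+k}`, and the other becomes `∂_τ` of an element of
    -- `V_{α+k}`.
    have e : tau • g = c⁻¹ • aeval D.tauD P (tau • g) -
        c⁻¹ • D.tauD (aeval D.tauD P.divX (tau • g)) := by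
      have e' : aeval D.tauD P (tau • g) =
          D.tauD (aeval D.tauD P.divX (tau • g)) + c • tau • g := by
        conv_lhs => rw [← P.X_mul_divX_add]
        rw [map_add, map_mul, aeval_X, aeval_C, LinearMap.add_apply, Module.End.mul_apply,
          Module.algebraMap_end_apply, coeff_zero_eq_eval_zero]
      rw [e', smul_add, add_sub_cancel_left, smul_smul, inv_mul_cancel₀ h0, one_smul]
    have hstab : ∀ Q : ℂ[X], aeval D.tauD Q (tau • g) ∈ V (α + k) := fun Q =>
      aeval_apply_mem (M := (V (α + k)).restrictScalars ℂ) (hV.tauD_mem _) Q hg'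
    refine ⟨(T (-1) : Laurent) • c⁻¹ • aeval D.tauD P (tau • g), ?_,
      -(c⁻¹ • aeval D.tauD P.divX (tau • g)), ?_, ?_⟩
    · refine hV.T_smul_mem (-1) (complex_smul_mem_of_subalgebra _ _ (hP _ hg')) ?_
      push_cast; linarith
    · exact neg_mem (complex_smul_mem_of_subalgebra _ _ (hstab _))
    · rw [D.d_eq_T_smul_tauD, map_neg, D.tauD.map_smul, ← smul_add, ← sub_eq_add_neg, ← e, tau,
        T_neg_smul_T_smul]
  nilpotent := hV.nilpotent

end Connection.IsLogFiltration

/-- With `N` a common denominator of the classes of jumps, no jump lies in `(⌊Nβ⌋ / N, β]`. -/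
theorem Connection.IsVFiltration.exists_floor {D : Connection G} {V : ℚ → Submodule PolyTau G}
    (hV : D.IsVFiltration V) : ∃ N : ℕ, 0 < N ∧ ∀ β : ℚ, V β = V (⌊N * β⌋ / N) := by
  obtain ⟨A, hA⟩ := hV.jumps
  have hN : 0 < ∏ a ∈ A, a.den := Finset.prod_pos fun a _ => a.den_pos
  refine ⟨∏ a ∈ A, a.den, hN, fun β => ?_⟩
  set N := ∏ a ∈ A, a.den
  have hN' : (0 : ℚ) < N := by exact_mod_cast hN
  refine (hA _ _ ?_ fun a ha k hk => ?_).symm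
  · rw [div_le_iff₀ hN', mul_comm]
    exact Int.floor_le _
  · obtain ⟨c, hc⟩ : a.den ∣ N := Finset.dvd_prod_of_mem _ ha
    have e : (N : ℚ) * (a + k) = (a.num * c + N * k : ℤ) := by
      have : (a.den : ℚ) * a = a.num := Rat.den_mul_eq_num a
      rw [mul_add]
      nth_rw 1 [hc]
      push_cast
      rw [← this]
      ring
    have h1 := hk.1
    rw [div_lt_iff₀ hN', mul_comm (a + _), e] at h1
    have h2 : (N : ℚ) * (a + k) ≤ N * β := by gcongr; exact hk.2
    rw [e] at h2
    have h3 := Int.le_floor.2 h2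
    have h4 : ⌊(N : ℚ) * β⌋ < (a.num * c + N * k : ℤ) := by exact_mod_cast h1
    omega

/-- Uniqueness of the Malgrange-Kashiwara filtration. -/
theorem Connection.IsVFiltration.eq_of_isLogFiltration {D : Connection G}
    {V V' : ℚ → Submodule PolyTau G} (hV' : D.IsVFiltration V') (hV : D.IsLogFiltration V) :
    V' = V := by
  obtain ⟨N, hN, hj⟩ := hV.jumps
  obtain ⟨N', hN', hj'⟩ := hV'.exists_floor
  have hE' : ∀ β, ∀ g ∈ V' β, D.tauD g ∈ V' β := fun β g hg => by
    have := hV'.tau_mem _ _ (hV'.d_mem β g hg)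
    rwa [add_sub_cancel_right] at this
  have hTV' : ∀ (β : ℚ) (n : ℕ) (g : G), g ∈ V' β → (T n : Laurent) • g ∈ V' (β - n) := by
    intro β n g hg
    induction n with
    | zero => simpa using hg
    | succ n ih =>
      have := hV'.tau_mem _ _ ih
      rw [tau, T_smul_T_smul] at this
      convert this using 2 <;> push_cast <;> ring_nf
  funext β
  apply le_antisymm
  · intro g hg
    -- A term of `V'` far enough down lies in `V_β`: finitely many generators over `ℂ[τ]⟨τ∂_τ⟩` put
    -- `V'_0` into some `V_c`, and far down `V'` moves by multiplication by `τ`.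
    obtain ⟨β₀, hβ, h₀⟩ : ∃ β₀ ≤ β, V' β₀ ≤ V β := by
      obtain ⟨S, hS, hW⟩ := hV'.finite_type 0
      obtain ⟨c, hc⟩ : ∃ c, V' 0 ≤ V c := by
        choose b hb using hV.exhaustive
        obtain ⟨c, hc⟩ := (S.image b).bddAbove
        exact ⟨c, hW _ (fun g hg => hV.mono
          (hc (Finset.mem_coe.2 (Finset.mem_image_of_mem b hg))) (hb g)) (hV.tauD_mem c)⟩
      obtain ⟨k₀, hk₀⟩ := hV'.tau_generates 0
      have hsh : ∀ n : ℕ, ∀ g ∈ V' (min k₀ 0 - n : ℤ), g ∈ V (c - n) := by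
        intro n
        induction n with
        | zero =>
          intro g hg
          have := hc (hV'.mono (by push_cast; simp) hg)
          simpa using this
        | succ n ih =>
          intro g hg
          obtain ⟨h, hh, rfl⟩ := hk₀ (min k₀ 0 - n) (by omega) g
            (by convert hg using 2; push_cast; ring)
          rw [zero_add] at hh
          have := (hV.tau_mem_iff _ _).2 (ih h hh)
          convert this using 2; push_cast; ring
      obtain ⟨n, hn⟩ := exists_nat_ge (max (c - β) (-β))
      refine ⟨(min k₀ 0 - n : ℤ), ?_, fun g hg => hV.mono ?_ (hsh n g hg)⟩
      · have h1 : ((min k₀ 0 : ℤ) : ℚ) ≤ 0 := by exact_mod_cast min_le_right _ _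
        have h2 := (le_max_right _ _).trans hn
        push_cast at h1 ⊢
        linarith
      · have h2 := (le_max_left _ _).trans hn
        linarith
    obtain ⟨P, hP, hPx⟩ := D.exists_aeval_mem_of_nilpotent hV'.mono hN' hj' hV'.nilpotent hβ
    obtain ⟨β', hβ'⟩ := hV.exhaustive g
    obtain ⟨Q, hQ, hQx⟩ := D.exists_aeval_mem_of_nilpotent hV.mono hN hj hV.nilpotent
      (le_max_left β β')
    -- The roots of `P` are numbers `-γ` with `γ ≤ β`, those of `Q` numbers `-δ` with `δ > β`.
    refine mem_of_aeval_apply_mem_of_no_common_root (M := (V β).restrictScalars ℂ)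
      (hV.tauD_mem β) (h₀ (hP g hg)) (hQ g (hV.mono (le_max_right _ _) hβ')) fun x hx hx' => ?_
    obtain ⟨γ, h1, h2, rfl⟩ := hPx x hx
    obtain ⟨δ, h3, h4, h5⟩ := hQx _ hx'
    rw [neg_inj, Rat.cast_inj] at h5
    linarith
  · intro g hg
    -- For `V'` only `τV'_β ⊆ V'_{β-1}` is available here, so the division by `τⁿ` takes place in
    -- `V` and only the multiplication in `V'`.
    obtain ⟨β₀, hβ, h₀⟩ : ∃ β₀ ≤ β, V β₀ ≤ V' β := by
      obtain ⟨c, hc⟩ := hV.exists_le_of_fg hV'.mono hV'.exhaustive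
      obtain ⟨n, hn⟩ := exists_nat_ge (max (c - β) (-β))
      have h2 := (le_max_right _ _).trans hn
      have h3 := (le_max_left _ _).trans hn
      refine ⟨-n, by linarith, fun g hg => ?_⟩
      have h4 := hTV' c n _ (hc (hV.T_smul_mem (-n) hg (γ := 0) (by simp)))
      rw [T_smul_T_neg_smul] at h4
      exact hV'.mono (by linarith) h4
    obtain ⟨P, hP, hPx⟩ := D.exists_aeval_mem_of_nilpotent hV.mono hN hj hV.nilpotent hβ
    obtain ⟨β', hβ'⟩ := hV'.exhaustive g
    obtain ⟨Q, hQ, hQx⟩ := D.exists_aeval_mem_of_nilpotent hV'.mono hN' hj' hV'.nilpotent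
      (le_max_left β β')
    refine mem_of_aeval_apply_mem_of_no_common_root (M := (V' β).restrictScalars ℂ)
      (hE' β) (h₀ (hP g hg)) (hQ g (hV'.mono (le_max_right _ _) hβ')) fun x hx hx' => ?_
    obtain ⟨γ, h1, h2, rfl⟩ := hPx x hx
    obtain ⟨δ, h3, h4, h5⟩ := hQx _ hx'
    rw [neg_inj, Rat.cast_inj] at h5
    linarith

/-- Turns the chosen `vFiltration` into any logarithmic filtration exhibited explicitly. -/
theorem Connection.IsLogFiltration.vFiltration_eq {D : Connection G}
    {V : ℚ → Submodule PolyTau G} (hV : D.IsLogFiltration V) : D.vFiltration = V := by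
  have h : ∃ V, D.IsVFiltration V := ⟨V, hV.isVFiltration⟩
  rw [Connection.vFiltration, dif_pos h]
  exact h.choose_spec.eq_of_isLogFiltration hV

end Filtrations

end MeroConn

namespace MeroConn

open Polynomial LaurentPolynomial

/-! ### Existence of the filtration: spectral decomposition modulo powers of `τ` -/

section Existence

theorem map_aeval_of_intertwine {A B : Type*} [AddCommGroup A] [Module ℂ A] [AddCommGroup B]
    [Module ℂ B] (f : A →ₗ[ℂ] B) {a : Module.End ℂ A} {b : Module.End ℂ B}
    (h : ∀ x, f (a x) = b (f x)) (P : ℂ[X]) (x : A) : f (aeval a P x) = aeval b P (f x) := by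
  induction P using Polynomial.induction_on generalizing x with
  | C r => simp
  | add p q hp hq => simp [hp, hq]
  | monomial k r ih =>
    have e : Polynomial.C r * X ^ (k + 1) = (Polynomial.C r * X ^ k) * X := by ring
    rw [e, map_mul (aeval (R := ℂ) a) _ X, map_mul (aeval (R := ℂ) b) _ X, Module.End.mul_apply,
      Module.End.mul_apply, aeval_X, aeval_X, ih, h]

variable {G : Type*} [AddCommGroup G] [Module ℂ G] [Module Laurent G] [IsScalarTower ℂ Laurent G]

/-- The subspace `τᵏ L`. -/
noncomputable def tauPow (L : Submodule PolyTau G) (k : ℤ) : Submodule ℂ G :=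
  (L.restrictScalars ℂ).comap ((LinearMap.lsmul Laurent G (T (-k))).restrictScalars ℂ)

theorem mem_tauPow {L : Submodule PolyTau G} {k : ℤ} {g : G} :
    g ∈ tauPow L k ↔ (T (-k) : Laurent) • g ∈ L := Iff.rfl

theorem mem_tauPow_zero {L : Submodule PolyTau G} {g : G} : g ∈ tauPow L 0 ↔ g ∈ L := by
  rw [mem_tauPow, neg_zero, T_zero, one_smul]

theorem T_smul_mem_tauPow {L : Submodule PolyTau G} {k m n : ℤ} {g : G} (hg : g ∈ tauPow L k)
    (h : n ≤ k + m) : (T m : Laurent) • g ∈ tauPow L n := by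
  rw [mem_tauPow] at hg ⊢
  have := T_smul_mem_of_polyTau L (n := k + m - n) (by omega) hg
  rw [T_smul_T_smul] at this ⊢
  convert this using 3
  ring

theorem tauPow_antitone (L : Submodule PolyTau G) : Antitone (tauPow L) := fun m n h g hg => by
  simpa using T_smul_mem_tauPow (m := 0) hg (n := m) (by omega)

namespace Connection.IsLogLattice

variable {D : Connection G} {L : Submodule PolyTau G}

theorem tauD_mem_tauPow (hL : D.IsLogLattice L) (k : ℤ) : ∀ g ∈ tauPow L k,
    D.tauD g ∈ tauPow L k := by
  intro g hg
  rw [mem_tauPow] at hg ⊢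
  have := D.tauD_T_smul (-k) g
  rw [smul_add, smul_comm _ ((-k : ℤ) : ℂ)] at this
  rw [eq_sub_of_add_eq this.symm]
  exact sub_mem (hL.tauD_mem _ hg) (complex_smul_mem_of_subalgebra _ _ hg)

theorem exists_mem_tauPow (hL : D.IsLogLattice L) (g : G) : ∃ k : ℤ, g ∈ tauPow L k := by
  have hg : g ∈ Submodule.span Laurent (L : Set G) := by rw [hL.span_eq_top]; trivial
  induction hg using Submodule.span_induction with
  | mem x hx => exact ⟨0, mem_tauPow_zero.2 hx⟩
  | zero => exact ⟨0, zero_mem _⟩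
  | add x y _ _ hx hy =>
    obtain ⟨a, ha⟩ := hx
    obtain ⟨b, hb⟩ := hy
    exact ⟨min a b, add_mem (tauPow_antitone L (min_le_left _ _) ha)
      (tauPow_antitone L (min_le_right _ _) hb)⟩
  | smul f x _ hx =>
    obtain ⟨a, ha⟩ := hx
    induction f using LaurentPolynomial.induction_on' with
    | add p q hp hq =>
      obtain ⟨b, hb⟩ := hp
      obtain ⟨c, hc⟩ := hq
      rw [add_smul]
      exact ⟨min b c, add_mem (tauPow_antitone L (min_le_left _ _) hb)
        (tauPow_antitone L (min_le_right _ _) hc)⟩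
    | C_mul_T n r =>
      refine ⟨a + n, ?_⟩
      rw [← LaurentPolynomial.smul_eq_C_mul, smul_assoc]
      exact (tauPow L _).smul_mem r (T_smul_mem_tauPow ha le_rfl)

/-- The right-hand side lies in `L`, so `τ` sends it into `τL`, which it contains; it is therefore a
`ℂ[τ]`-module containing the generators. Hence `L / τL` is finite-dimensional. -/
theorem le_span_sup_tauPow {S : Finset G} (hS : Submodule.span PolyTau (S : Set G) = L) :
    L.restrictScalars ℂ ≤ Submodule.span ℂ (S : Set G) ⊔ tauPow L 1 := by
  have hSL : Submodule.span ℂ (S : Set G) ≤ L.restrictScalars ℂ := by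
    rw [Submodule.span_le, ← hS]
    exact Submodule.subset_span
  have hst : ∀ g ∈ Submodule.span ℂ (S : Set G) ⊔ tauPow L 1,
      tau • g ∈ Submodule.span ℂ (S : Set G) ⊔ tauPow L 1 := by
    intro g hg
    have hle : Submodule.span ℂ (S : Set G) ⊔ tauPow L 1 ≤ L.restrictScalars ℂ :=
      sup_le hSL fun x hx => mem_tauPow_zero.1 (tauPow_antitone L zero_le_one hx)
    exact Submodule.mem_sup_right
      (T_smul_mem_tauPow (k := 0) (mem_tauPow_zero.2 (hle hg)) (by omega))
  have : L ≤ adjoinSubmodule _ hst := by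
    conv_lhs => rw [← hS]
    rw [Submodule.span_le]
    exact fun s hs => Submodule.mem_sup_left (Submodule.subset_span hs)
  exact this

/-- A polynomial with rational roots in `τ∂_τ` which sends `L` into `τL`. -/
theorem exists_residue_polynomial (hL : D.IsLogLattice L)
    (hq : ∀ c : ℂ, D.IsResidueEigenvalue L c → ∃ q : ℚ, c = (q : ℂ)) :
    ∃ P : ℂ[X], P ≠ 0 ∧ (∀ g ∈ L, aeval D.tauD P g ∈ tauPow L 1) ∧
      ∀ x, P.eval x = 0 → ∃ q : ℚ, x = (q : ℂ) := by
  let M := L.restrictScalars ℂ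
  let A : Module.End ℂ M := D.tauD.restrict hL.tauD_mem
  let K : Submodule ℂ M := (tauPow L 1).submoduleOf M
  have hK : K ≤ K.comap A := fun g hg => hL.tauD_mem_tauPow 1 g hg
  let B : Module.End ℂ (M ⧸ K) := K.mapQ K A hK
  have hfin : Module.Finite ℂ (M ⧸ K) := by
    obtain ⟨S, hS⟩ := hL.fg
    have hSM : ∀ s ∈ S, s ∈ M := fun s hs => by
      change s ∈ L
      rw [← hS]
      exact Submodule.subset_span hs
    have : ∀ x : M ⧸ K, x ∈ Submodule.span ℂ (Set.range fun s : S => K.mkQ ⟨s, hSM s s.2⟩) := by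
      intro x
      obtain ⟨⟨g, hg⟩, rfl⟩ := K.mkQ_surjective x
      obtain ⟨u, hu, v, hv, rfl⟩ := Submodule.mem_sup.1 (le_span_sup_tauPow hS hg)
      have hu' : u ∈ M := by
        have hle : Submodule.span ℂ (S : Set G) ≤ M := Submodule.span_le.2 hSM
        exact hle hu
      have e : K.mkQ ⟨u + v, hg⟩ = K.mkQ ⟨u, hu'⟩ := by
        rw [← sub_eq_zero, ← map_sub, Submodule.mkQ_apply, Submodule.Quotient.mk_eq_zero]
        change u + v - u ∈ tauPow L 1
        rwa [add_sub_cancel_left]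
      rw [e]
      clear e hg hv v
      induction hu using Submodule.span_induction with
      | mem x hx => exact Submodule.subset_span ⟨⟨x, hx⟩, rfl⟩
      | zero => exact (map_zero K.mkQ) ▸ zero_mem _
      | add x y hx hy ihx ihy =>
        have hle : Submodule.span ℂ (S : Set G) ≤ M := Submodule.span_le.2 hSM
        have := add_mem (ihx (hle hx)) (ihy (hle hy))
        rwa [← map_add] at this
      | smul r x hx ih =>
        have hle : Submodule.span ℂ (S : Set G) ≤ M := Submodule.span_le.2 hSM
        have := Submodule.smul_mem _ r (ih (hle hx))
        rwa [← map_smul] at this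
    have hr := Set.finite_range fun s : S => K.mkQ ⟨s, hSM s s.2⟩
    exact ⟨⟨hr.toFinset, by rw [hr.coe_toFinset]; exact eq_top_iff.2 fun x _ => this x⟩⟩
  -- The minimal polynomial of the residue kills `L / τL`, and its roots are eigenvalues of the
  -- residue.
  refine ⟨minpoly ℂ B, minpoly.ne_zero (Algebra.IsIntegral.isIntegral B), fun g hg => ?_,
    fun x hx => hq x ?_⟩
  · have h1 := map_aeval_of_intertwine K.mkQ (a := A) (b := B) (fun _ => rfl) (minpoly ℂ B) ⟨g, hg⟩
    rw [minpoly.aeval, LinearMap.zero_apply, Submodule.mkQ_apply,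
      Submodule.Quotient.mk_eq_zero] at h1
    have h2 := map_aeval_of_intertwine M.subtype (a := A) (b := D.tauD) (fun _ => rfl)
      (minpoly ℂ B) ⟨g, hg⟩
    rw [Submodule.subtype_apply, Submodule.subtype_apply] at h2
    rw [← h2]
    exact h1
  · obtain ⟨v, hv⟩ := (Module.End.hasEigenvalue_of_isRoot (f := B) hx).exists_hasEigenvector
    obtain ⟨⟨g, hg⟩, rfl⟩ := K.mkQ_surjective v
    refine ⟨g, hg, ?_, (T (-1) : Laurent) • (D.tauD g - x • g), ?_, (T_smul_T_neg_smul 1 _).symm⟩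
    · rintro ⟨h, hh, rfl⟩
      refine hv.2 ?_
      rw [Submodule.mkQ_apply, Submodule.Quotient.mk_eq_zero]
      exact T_smul_mem_tauPow (k := 0) (mem_tauPow_zero.2 hh) (by omega)
    · have h := hv.apply_eq_smul
      rw [← map_smul, ← sub_eq_zero] at h
      change K.mkQ (A ⟨g, hg⟩) - _ = 0 at h
      rw [← map_sub, Submodule.mkQ_apply, Submodule.Quotient.mk_eq_zero] at h
      exact h

/-- Polynomials in `τ∂_τ` which send `τᵃ L` into `τᵃ⁺ᵈ L`, and their roots. -/
theorem exists_residue_polynomials (hL : D.IsLogLattice L)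
    (hq : ∀ c : ℂ, D.IsResidueEigenvalue L c → ∃ q : ℚ, c = (q : ℂ)) :
    ∃ N c : ℕ, 0 < N ∧ ∀ (a b : ℤ), a ≤ b → ∃ P : ℂ[X],
      (∀ g ∈ tauPow L a, aeval D.tauD P g ∈ tauPow L b) ∧
      ∀ x, P.eval x = 0 → ∃ p j : ℤ, |p| ≤ c ∧ a ≤ j ∧ j < b ∧
        x = -((-(p + N * j) : ℤ) / N : ℚ) := by
  obtain ⟨Q, hQ0, hQL, hQ⟩ := hL.exists_residue_polynomial hq
  choose! q hq using hQ
  let S := Q.roots.toFinset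
  have hS : ∀ x, Q.eval x = 0 → x ∈ S := fun x hx =>
    Multiset.mem_toFinset.2 ((mem_roots hQ0).2 hx)
  let N := ∏ x ∈ S, (q x).den
  have hN : 0 < N := Finset.prod_pos fun x _ => (q x).den_pos
  have hN' : (N : ℚ) ≠ 0 := by exact_mod_cast hN.ne'
  have hp : ∀ x, ∃ p : ℤ, x ∈ S → q x = p / N := by
    intro x
    by_cases hx : x ∈ S
    · obtain ⟨c, hc⟩ : (q x).den ∣ N := Finset.dvd_prod_of_mem (fun x => (q x).den) hx
      refine ⟨(q x).num * c, fun _ => ?_⟩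
      rw [eq_div_iff hN', hc]
      have : ((q x).den : ℚ) * q x = (q x).num := Rat.den_mul_eq_num _
      push_cast
      rw [← this]
      ring
    · exact ⟨0, fun h => absurd h hx⟩
  choose p hp using hp
  obtain ⟨c, hc⟩ := (S.image fun x => (p x).natAbs).bddAbove
  -- `N` is a common denominator of the roots of `Q`, which are the `p / N` with `|p| ≤ c`. On `τʲL
  -- / τʲ⁺¹L` they become `p / N + j = -γ` with `γ = -(p + Nj) / N`.
  refine ⟨N, c, hN, fun a b hab => ?_⟩
  obtain ⟨d, rfl⟩ := Int.le.dest hab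
  clear hab
  induction d with
  | zero => exact ⟨1, by simp, by simp⟩
  | succ d ih =>
    obtain ⟨P, hP, hPx⟩ := ih
    -- Crossing `τ^(a+d)` translates `τ∂_τ` by `a + d`, and the substitution undoes this.
    refine ⟨Q.comp (X - Polynomial.C ((a + d : ℤ) : ℂ)) * P, fun g hg => ?_, fun x hx => ?_⟩
    · rw [map_mul, Module.End.mul_apply]
      have h1 := hP g hg
      set h := aeval D.tauD P g
      rw [← T_smul_T_neg_smul (a + d) h, D.aeval_tauD_T_smul, comp_assoc]
      simp only [sub_comp, X_comp, C_comp, add_sub_cancel_right, comp_X]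
      exact T_smul_mem_tauPow (hQL _ h1) (by push_cast; omega)
    · rw [eval_mul, mul_eq_zero, eval_comp, eval_sub, eval_X, eval_C] at hx
      rcases hx with hx | hx
      · obtain ⟨y, rfl⟩ : ∃ y, x = y + ((a + d : ℤ) : ℂ) := ⟨_, (sub_add_cancel _ _).symm⟩
        rw [add_sub_cancel_right] at hx
        have hxS := hS _ hx
        refine ⟨p y, a + d, ?_, by omega, by push_cast; omega, ?_⟩
        · have : (p y).natAbs ≤ c :=
            hc (Finset.mem_coe.2 (Finset.mem_image_of_mem (fun x => (p x).natAbs) hxS))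
          rw [Int.abs_eq_natAbs]
          exact_mod_cast this
        · have e := hq _ hx
          rw [hp _ hxS] at e
          have hN'' : (N : ℂ) ≠ 0 := by exact_mod_cast hN.ne'
          push_cast at e ⊢
          generalize p y = m at e ⊢
          rw [e]
          field_simp
      · obtain ⟨p, j, h1, h2, h3, h4⟩ := hPx x hx
        exact ⟨p, j, h1, h2, by push_cast; omega, h4⟩

/-- The elements on which `τ∂_τ` acts, modulo each `τᵏ L`, with eigenvalues `-γ`, `γ ≤ β`. -/
noncomputable def spectralSubmodule (hL : D.IsLogLattice L) (β : ℚ) : Submodule ℂ G where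
  carrier := {g | ∀ k : ℤ, ∃ P : ℂ[X], aeval D.tauD P g ∈ tauPow L k ∧
    ∀ x, P.eval x = 0 → ∃ γ : ℚ, γ ≤ β ∧ x = -(γ : ℂ)}
  zero_mem' k := ⟨1, by simp, by simp⟩
  add_mem' := by
    intro g h hg hh k
    obtain ⟨P, hP, hPx⟩ := hg k
    obtain ⟨Q, hQ, hQx⟩ := hh k
    refine ⟨P * Q, ?_, fun x hx => ?_⟩
    · rw [map_add]
      refine add_mem (aeval_mul_apply_mem (hL.tauD_mem_tauPow k) _ hP) ?_
      rw [mul_comm]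
      exact aeval_mul_apply_mem (hL.tauD_mem_tauPow k) _ hQ
    · rw [eval_mul, mul_eq_zero] at hx
      exact hx.elim (hPx x) (hQx x)
  smul_mem' := by
    intro r g hg k
    obtain ⟨P, hP, hPx⟩ := hg k
    exact ⟨P, by rw [map_smul]; exact Submodule.smul_mem _ r hP, hPx⟩

theorem spectralSubmodule_mono (hL : D.IsLogLattice L) : Monotone hL.spectralSubmodule := by
  intro β γ h g hg k
  obtain ⟨P, hP, hPx⟩ := hg k
  exact ⟨P, hP, fun x hx => (hPx x hx).imp fun _ => And.imp_left fun h' => h'.trans h⟩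

theorem aeval_mem_spectralSubmodule (hL : D.IsLogLattice L) (Q : ℂ[X]) {β : ℚ} {g : G}
    (hg : g ∈ hL.spectralSubmodule β) : aeval D.tauD Q g ∈ hL.spectralSubmodule β := by
  intro k
  obtain ⟨P, hP, hPx⟩ := hg k
  refine ⟨P, ?_, hPx⟩
  rw [← Module.End.mul_apply, ← map_mul]
  exact aeval_mul_apply_mem (hL.tauD_mem_tauPow k) _ hP

theorem T_smul_mem_spectralSubmodule (hL : D.IsLogLattice L) (m : ℤ) {β : ℚ} {g : G}
    (hg : g ∈ hL.spectralSubmodule β) :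
    (T m : Laurent) • g ∈ hL.spectralSubmodule (β - m) := by
  intro k
  obtain ⟨P, hP, hPx⟩ := hg (k - m)
  refine ⟨P.comp (X - Polynomial.C (m : ℂ)), ?_, fun x hx => ?_⟩
  · rw [D.aeval_tauD_T_smul, comp_assoc]
    simp only [sub_comp, X_comp, C_comp, add_sub_cancel_right, comp_X]
    exact T_smul_mem_tauPow hP (by omega)
  · rw [eval_comp, eval_sub, eval_X, eval_C] at hx
    obtain ⟨γ, h1, h2⟩ := hPx _ hx
    refine ⟨γ - m, by linarith, ?_⟩
    rw [eq_add_of_sub_eq h2]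
    push_cast
    ring

theorem fg_tauPow (hL : D.IsLogLattice L) (k : ℤ) {W : Submodule PolyTau G}
    (hW : ∀ g ∈ W, g ∈ tauPow L k) : W.FG :=
  (hL.fg.map ((LinearMap.lsmul Laurent G (T k : Laurent)).restrictScalars PolyTau)).of_le
    fun g hg => ⟨(T (-k) : Laurent) • g, hW g hg, T_smul_T_neg_smul k g⟩

end Connection.IsLogLattice

open Connection.IsLogLattice in
/-- Existence of the Malgrange-Kashiwara filtration. -/
theorem Connection.IsRegularQuasiUnipotent.exists_isLogFiltration {D : Connection G}
    (hD : D.IsRegularQuasiUnipotent) : ∃ V, D.IsLogFiltration V := by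
  obtain ⟨L, hL, hq⟩ := hD
  obtain ⟨N, c, hN, hpol⟩ := hL.exists_residue_polynomials hq
  have hNq : (0 : ℚ) < N := by exact_mod_cast hN
  have hNz : (0 : ℤ) < N := by exact_mod_cast hN
  let U : ℤ → Submodule ℂ G := fun n => hL.spectralSubmodule (n / N)
  have hUmono : Monotone U := fun m n h => hL.spectralSubmodule_mono
    (div_le_div_of_nonneg_right (by exact_mod_cast h) hNq.le)
  have hUT : ∀ (m n : ℤ) (g : G), g ∈ U n → (T m : Laurent) • g ∈ U (n - N * m) := by
    intro m n g hg
    have := hL.T_smul_mem_spectralSubmodule m hg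
    convert this using 2
    push_cast
    field_simp
  -- The roots of the polynomials of `hpol`.
  have hroot : ∀ (p j n : ℤ) (γ : ℚ), γ ≤ n / N →
      (-((-(p + N * j) : ℤ) / N : ℚ) : ℂ) = -(γ : ℂ) → -(p + N * j) ≤ n ∧
        γ = (-(p + N * j) : ℤ) / N := by
    intro p j n γ hγ h
    have h' : γ = (-(p + N * j) : ℤ) / N := by
      rw [neg_inj] at h
      exact_mod_cast h.symm
    refine ⟨?_, h'⟩
    rw [h', div_le_div_iff_of_pos_right hNq] at hγ
    exact_mod_cast hγ
  -- On `τᵃL` only the indices `j ≥ a` occur, so `Nγ = -(p + Nj) ≤ c - Na`.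
  have hexh : ∀ a : ℤ, tauPow L a ≤ U (c - N * a) := by
    intro a g hg k
    rcases le_total k a with hk | hk
    · exact ⟨1, by simpa using tauPow_antitone L hk hg, by simp⟩
    · obtain ⟨P, hP, hPx⟩ := hpol a k hk
      refine ⟨P, hP g hg, fun x hx => ?_⟩
      obtain ⟨p, j, h1, h2, h3, rfl⟩ := hPx x hx
      refine ⟨_, ?_, rfl⟩
      rw [div_le_div_iff_of_pos_right hNq]
      have h4 : (N : ℤ) * a ≤ N * j := by gcongr
      have h5 := abs_le.1 h1
      have : -(p + N * j) ≤ c - N * a := by linarith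
      exact_mod_cast this
  -- For `j < -(|n| + c)` the eigenvalues `-γ` on `τʲL / τʲ⁺¹L` satisfy `Nγ > |n| ≥ n`. An element
  -- of `U n` in `τʲL` thus lies in `τʲ⁺¹L`, and climbs until `j = -(|n| + c)`.
  have hbdd : ∀ n : ℤ, ∃ a : ℤ, U n ≤ tauPow L a := by
    intro n
    refine ⟨-(|n| + c), fun g hg => ?_⟩
    obtain ⟨j₀, hj₀⟩ := hL.exists_mem_tauPow g
    have hstep : ∀ d : ℕ, g ∈ tauPow L (min (j₀ + d) (-(|n| + c))) := by
      intro d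
      induction d with
      | zero => exact tauPow_antitone L (by simp) hj₀
      | succ d ih =>
        by_cases hlt : j₀ + d < -(|n| + c)
        · rw [min_eq_left hlt.le] at ih
          rw [min_eq_left (by push_cast; omega)]
          obtain ⟨P, hP, hPx⟩ := hpol (j₀ + d) (j₀ + (d + 1 : ℕ)) (by push_cast; omega)
          obtain ⟨Q, hQ, hQx⟩ := hg (j₀ + (d + 1 : ℕ))
          refine mem_of_aeval_apply_mem_of_no_common_root (hL.tauD_mem_tauPow _) (hP g ih) hQ
            fun x hx hx' => ?_
          obtain ⟨p, j, h1, h2, h3, rfl⟩ := hPx x hx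
          obtain ⟨γ, hγ, hγ'⟩ := hQx _ hx'
          have h4 := (hroot p j n γ hγ hγ').1
          have h5 : j < -(|n| + c) := by push_cast at h3; omega
          have h6 := abs_le.1 h1
          have h7 := le_abs_self n
          have h8 := abs_nonneg n
          have h9 : (N : ℤ) * j ≤ j := by nlinarith
          have h10 := neg_abs_le n
          linarith
        · rw [min_eq_right (by push_cast; omega)]
          rwa [min_eq_right (by omega)] at ih
    have := hstep (-(|n| + c) - j₀).toNat
    rwa [min_eq_right (by omega)] at this
  have hnil : ∀ n : ℤ, ∃ M : ℕ, ∀ g ∈ U n,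
      aeval D.tauD ((X + Polynomial.C (((n / N : ℚ)) : ℂ)) ^ M) g ∈ U (n - 1) := by
    intro n
    obtain ⟨a, ha⟩ := hbdd n
    -- Beyond `τᴷL` one has `Nγ ≤ c - K < n`, so the eigenvalue `-n / N` has to be removed only
    -- between `τᵃL` and `τᴷL`. Its multiplicity `M` in the single polynomial `Q` then serves for
    -- every `k`.
    set K := max a (c + |n| + 1) with hK
    obtain ⟨Q, hQ, hQx⟩ := hpol a K (le_max_left _ _)
    have hQ0 : Q ≠ 0 := by
      rintro rfl
      -- The zero polynomial would vanish at `i`, while all roots of `Q` are rational.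
      obtain ⟨p, j, -, -, -, h⟩ := hQx Complex.I (by simp)
      have := congrArg Complex.im h
      simp at this
    obtain ⟨Q₁, hQ₁, hdvd⟩ := exists_eq_pow_rootMultiplicity_mul_and_not_dvd Q hQ0
      (-(((n / N : ℚ)) : ℂ))
    rw [dvd_iff_isRoot] at hdvd
    rw [map_neg, sub_neg_eq_add] at hQ₁
    set M := Q.rootMultiplicity (-(((n / N : ℚ)) : ℂ))
    refine ⟨M, fun g hg => ?_⟩
    set h := aeval D.tauD ((X + Polynomial.C (((n / N : ℚ)) : ℂ)) ^ M) g with hh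
    have hhU : h ∈ U n := hL.aeval_mem_spectralSubmodule _ hg
    have hQh : aeval D.tauD Q₁ h ∈ tauPow L K := by
      rw [hh, ← Module.End.mul_apply, ← map_mul, mul_comm, ← hQ₁]
      exact hQ g (ha hg)
    intro k
    obtain ⟨Q₂, hQ₂, hQ₂x⟩ := hpol K (max k K) (le_max_right _ _)
    obtain ⟨P, hP, hPx⟩ := hhU (max k K)
    have hQQ : aeval D.tauD (Q₂ * Q₁) h ∈ tauPow L (max k K) := by
      rw [map_mul, Module.End.mul_apply]
      exact hQ₂ _ hQh
    obtain ⟨R, hR, hRx⟩ := exists_aeval_apply_mem_of_common_roots (hL.tauD_mem_tauPow _) hP hQQ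
    refine ⟨R, tauPow_antitone L (le_max_left _ _) hR, fun x hx => ?_⟩
    obtain ⟨hxP, hxQ⟩ := hRx x hx
    obtain ⟨γ, hγ, rfl⟩ := hPx x hxP
    refine ⟨γ, ?_, rfl⟩
    have key : ∀ m : ℤ, γ = m / N → m ≤ n - 1 → γ ≤ (n - 1 : ℤ) / N := by
      rintro m rfl hm
      exact div_le_div_of_nonneg_right (by exact_mod_cast hm) hNq.le
    rw [eval_mul, mul_eq_zero] at hxQ
    rcases hxQ with hxQ | hxQ
    · obtain ⟨p, j, h1, h2, h3, h4⟩ := hQ₂x _ hxQ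
      obtain ⟨h5, h6⟩ := hroot p j n γ hγ h4.symm
      refine key _ h6 ?_
      have h7 := abs_le.1 h1
      have h8 := neg_abs_le n
      have h9 : c + |n| + 1 ≤ j := (le_max_right _ _).trans h2
      have h10 : j ≤ N * j := by nlinarith [abs_nonneg n]
      linarith
    · have hxQ' : Q.eval (-(γ : ℂ)) = 0 := by rw [hQ₁, eval_mul, hxQ, mul_zero]
      obtain ⟨p, j, h1, h2, h3, h4⟩ := hQx _ hxQ'
      obtain ⟨h5, h6⟩ := hroot p j n γ hγ h4.symm
      refine key _ h6 (Int.le_sub_one_of_lt (lt_of_le_of_ne h5 fun h7 => hdvd ?_))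
      rw [h7] at h6
      rw [IsRoot, ← h6]
      exact hxQ
  have hst : ∀ n, ∀ g ∈ U n, tau • g ∈ U n := fun n g hg =>
    hUmono (by simp) (hUT 1 n g hg)
  have hfl : ∀ (β : ℚ) (m : ℤ), ⌊(N : ℚ) * (β - m)⌋ = ⌊(N : ℚ) * β⌋ - N * m := by
    intro β m
    rw [mul_sub, show (N : ℚ) * m = ((N * m : ℤ) : ℚ) by push_cast; ring, Int.floor_sub_intCast]
  refine ⟨fun β => adjoinSubmodule (U ⌊N * β⌋) (hst _), ?_⟩
  have hfloor : ∀ n : ℤ, ⌊(N : ℚ) * (n / N : ℚ)⌋ = n := fun n => by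
    rw [mul_div_cancel₀ _ hNq.ne', Int.floor_intCast]
  refine ⟨?_, ⟨N, hN, ?_⟩, ?_, ?_, ?_, ?_, ?_⟩
  · exact fun β γ h => hUmono (Int.floor_mono (by gcongr))
  · intro β
    simp only [hfloor]
  · intro g
    obtain ⟨k, hk⟩ := hL.exists_mem_tauPow g
    refine ⟨(c - N * k : ℤ) / N, ?_⟩
    simp only [hfloor]
    exact hexh k hk
  · intro β g
    have h1 := hfl β 1
    push_cast at h1
    simp only [mem_adjoinSubmodule, h1, mul_one]
    refine ⟨fun h => ?_, fun h => by simpa [tau] using hUT 1 _ _ h⟩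
    have := hUT (-1) _ _ h
    rw [tau, T_neg_smul_T_smul] at this
    simpa using this
  · intro β g hg
    have := hL.aeval_mem_spectralSubmodule X hg
    rwa [aeval_X] at this
  · obtain ⟨a, ha⟩ := hbdd ⌊(N : ℚ) * 0⌋
    exact hL.fg_tauPow a fun g hg => ha hg
  · intro β
    -- When `Nβ` is not an integer there is no jump at `β`, and `V_β = V_{<β}`: the exponent `0`
    -- suffices.
    rcases lt_or_eq_of_le (Int.floor_le ((N : ℚ) * β)) with h | h
    · refine ⟨0, fun g hg => ?_⟩
      rw [pow_zero, Module.End.one_apply]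
      refine le_VLt _ (γ := ⌊(N : ℚ) * β⌋ / N) (by rwa [div_lt_iff₀' hNq]) ?_
      simp only [hfloor]
      exact hg
    · obtain ⟨M, hM⟩ := hnil ⌊(N : ℚ) * β⌋
      have hβ : (⌊(N : ℚ) * β⌋ : ℚ) / N = β := by
        rw [h]
        field_simp
      refine ⟨M, fun g hg => ?_⟩
      have := hM g hg
      rw [hβ, D.aeval_X_add_C_pow] at this
      refine le_VLt _ (γ := (⌊(N : ℚ) * β⌋ - 1 : ℤ) / N) ?_ ?_
      · rw [div_lt_iff₀' hNq]
        push_cast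
        linarith
      · simp only [hfloor]
        exact this

end Existence

end MeroConn

namespace MeroConn

open LaurentPolynomial

/-! ### The monomials `τᵐ eᵢ` as a basis over `ℂ` -/

section Monomials

variable {G : Type*} [AddCommGroup G] [Module ℂ G] [Module Laurent G] [IsScalarTower ℂ Laurent G]
variable {ι : Type*}

theorem mem_polyTheta_of_coeff {p : Laurent} (h : ∀ n : ℤ, 0 < n → p.coeff n = 0) :
    p ∈ PolyTheta := by
  rw [← AddMonoidAlgebra.sum_coeff_single p, Finsupp.sum]
  refine sum_mem fun n hn => ?_
  have hn0 : n ≤ 0 := not_lt.1 fun hn0 => (Finsupp.mem_support_iff.1 hn) (h n hn0)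
  obtain ⟨m, rfl⟩ : ∃ m : ℕ, n = -m := ⟨n.natAbs, by omega⟩
  rw [single_eq_C_mul_T, ← LaurentPolynomial.smul_eq_C_mul]
  exact PolyTheta.smul_mem (T_mem_polyTheta m) _

theorem coeff_T_mul (m n : ℤ) (p : Laurent) : (T m * p).coeff n = p.coeff (n - m) := by
  rw [T, AddMonoidAlgebra.coeff_single_mul_apply, one_mul, neg_add_eq_sub]

theorem exists_T_mul_mem_polyTheta (p : Laurent) :
    ∃ M : ℤ, ∀ m, M ≤ m → T (-m) * p ∈ PolyTheta := by
  obtain ⟨M, hM⟩ := p.coeff.support.bddAbove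
  refine ⟨M, fun m hm => mem_polyTheta_of_coeff fun n hn => ?_⟩
  rw [coeff_T_mul]
  by_contra h
  have := hM (Finset.mem_coe.2 (Finsupp.mem_support_iff.2 h))
  omega

/-- The span of the `τᵐ eᵢ` for `(i, m)` in `P`. -/
noncomputable def monomialSpan (e : ι → G) (P : Set (ι × ℤ)) : Submodule ℂ G :=
  Submodule.span ℂ ((fun p : ι × ℤ => (T p.2 : Laurent) • e p.1) '' P)

theorem T_smul_mem_monomialSpan (e : ι → G) {P : Set (ι × ℤ)} {i : ι} {m : ℤ} (h : (i, m) ∈ P) :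
    (T m : Laurent) • e i ∈ monomialSpan e P :=
  Submodule.subset_span ⟨(i, m), h, rfl⟩

theorem monomialSpan_le {e : ι → G} {P : Set (ι × ℤ)} {M : Submodule ℂ G} :
    monomialSpan e P ≤ M ↔ ∀ i m, (i, m) ∈ P → (T m : Laurent) • e i ∈ M := by
  rw [monomialSpan, Submodule.span_le, Set.image_subset_iff]
  exact ⟨fun h i m hp => h hp, fun h p hp => h p.1 p.2 hp⟩

theorem monomialSpan_mono (e : ι → G) {P Q : Set (ι × ℤ)} (h : P ⊆ Q) :
    monomialSpan e P ≤ monomialSpan e Q :=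
  Submodule.span_mono (Set.image_mono h)

theorem T_smul_mem_monomialSpan_of_mem {e : ι → G} {P Q : Set (ι × ℤ)} {k : ℤ}
    (h : ∀ i m, (i, m) ∈ P → (i, k + m) ∈ Q) {g : G} (hg : g ∈ monomialSpan e P) :
    (T k : Laurent) • g ∈ monomialSpan e Q := by
  have : monomialSpan e P ≤ (monomialSpan e Q).comap
      ((LinearMap.lsmul Laurent G (T k : Laurent)).restrictScalars ℂ) := by
    refine monomialSpan_le.2 fun i m hp => ?_
    change (T k : Laurent) • (T m : Laurent) • e i ∈ monomialSpan e Q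
    rw [T_smul_T_smul]
    exact T_smul_mem_monomialSpan e (h i m hp)
  exact this hg

/-- The basis over `ℂ` consisting of the `τᵐ eᵢ`. -/
noncomputable def monomialBasis (e : Module.Basis ι Laurent G) : Module.Basis (ι × ℤ) ℂ G :=
  (AddMonoidAlgebra.basis ℤ ℂ).smulTower' e

theorem monomialBasis_apply (e : Module.Basis ι Laurent G) (p : ι × ℤ) :
    monomialBasis e p = (T p.2 : Laurent) • e p.1 := by
  rw [monomialBasis, Module.Basis.smulTower'_apply, AddMonoidAlgebra.basis_apply]
  rfl

theorem monomialSpan_eq (e : Module.Basis ι Laurent G) (P : Set (ι × ℤ)) :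
    monomialSpan e P = Submodule.span ℂ (monomialBasis e '' P) := by
  rw [monomialSpan]
  congr 2
  ext p
  rw [monomialBasis_apply]

theorem mem_monomialSpan_iff {e : Module.Basis ι Laurent G} {P : Set (ι × ℤ)} {g : G} :
    g ∈ monomialSpan e P ↔ (((monomialBasis e).repr g).support : Set (ι × ℤ)) ⊆ P := by
  rw [monomialSpan_eq, Module.Basis.mem_span_image]

/-- Holds because the monomials are independent over `ℂ`. With `monomialSpan_union` it reduces the
subspaces in `ν_β` to operations on sets of indices. -/
theorem monomialSpan_inter (e : Module.Basis ι Laurent G) (P Q : Set (ι × ℤ)) :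
    monomialSpan e P ⊓ monomialSpan e Q = monomialSpan e (P ∩ Q) := by
  ext g
  rw [Submodule.mem_inf, mem_monomialSpan_iff, mem_monomialSpan_iff, mem_monomialSpan_iff,
    Set.subset_inter_iff]

theorem monomialSpan_union (e : ι → G) (P Q : Set (ι × ℤ)) :
    monomialSpan e P ⊔ monomialSpan e Q = monomialSpan e (P ∪ Q) := by
  rw [monomialSpan, monomialSpan, ← Submodule.span_union, ← Set.image_union, monomialSpan]

end Monomials

/-! ### Simultaneous splitting of a filtration and a lattice -/

section Lattices

universe u

variable {G : Type u} [AddCommGroup G] [Module ℂ G] [Module Laurent G] [IsScalarTower ℂ Laurent G]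

/-- A relation has finitely many coefficients, and a power of `θ` brings them all into `ℂ[θ]`. -/
theorem linearIndependent_of_polyTheta {ι : Type*} {v : ι → G}
    (h : LinearIndependent PolyTheta v) : LinearIndependent Laurent v := by
  rw [linearIndependent_iff'] at h ⊢
  intro s f hf i hi
  choose M hM using fun i => exists_T_mul_mem_polyTheta (f i)
  obtain ⟨m, hm⟩ := (s.image M).bddAbove
  have hmem : ∀ i ∈ s, T (-m) * f i ∈ PolyTheta := fun i hi =>
    hM i m (hm (Finset.mem_coe.2 (Finset.mem_image_of_mem M hi)))
  classical
  let f' : ι → PolyTheta := fun i => if hi : i ∈ s then ⟨_, hmem i hi⟩ else 0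
  have hf' : ∀ i ∈ s, ((f' i : PolyTheta) : Laurent) = T (-m) * f i := fun i hi => by
    simp only [f', dif_pos hi]
  have h0 : ∑ i ∈ s, f' i • v i = 0 := by
    have : ∑ i ∈ s, f' i • v i = (T (-m) : Laurent) • ∑ i ∈ s, f i • v i := by
      rw [Finset.smul_sum]
      refine Finset.sum_congr rfl fun i hi => ?_
      rw [smul_smul, ← hf' i hi]
      rfl
    rw [this, hf, smul_zero]
  have h1 := h s f' h0 i hi
  have h2 := hf' i hi
  rw [h1] at h2
  have h3 := congrArg (fun p => T m * p) h2
  simp only [← mul_assoc, ← T_add, add_neg_cancel, T_zero, one_mul] at h3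
  simpa using h3.symm

namespace Connection.IsLattice

variable {D : Connection G} {G₀ : Submodule PolyTheta G}

theorem exists_T_smul_mem (h : D.IsLattice G₀) (g : G) : ∃ k : ℤ, (T k : Laurent) • g ∈ G₀ := by
  have hle : ∀ {k m : ℤ} {g : G}, (T k : Laurent) • g ∈ G₀ → m ≤ k → (T m : Laurent) • g ∈ G₀ := by
    intro k m g hg hm
    have := T_smul_mem_of_polyTheta G₀ (n := m - k) (by omega) hg
    rwa [T_smul_T_smul, sub_add_cancel] at this
  have hg : g ∈ Submodule.span Laurent (G₀ : Set G) := by rw [h.span_eq_top]; trivial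
  induction hg using Submodule.span_induction with
  | mem x hx => exact ⟨0, by simpa using hx⟩
  | zero => exact ⟨0, by simp⟩
  | add x y _ _ hx hy =>
    obtain ⟨a, ha⟩ := hx
    obtain ⟨b, hb⟩ := hy
    refine ⟨min a b, ?_⟩
    rw [smul_add]
    exact add_mem (hle ha (min_le_left _ _)) (hle hb (min_le_right _ _))
  | smul f x _ hx =>
    obtain ⟨a, ha⟩ := hx
    obtain ⟨M, hM⟩ := exists_T_mul_mem_polyTheta f
    refine ⟨-M + a, ?_⟩
    have := G₀.smul_mem ⟨_, hM M le_rfl⟩ ha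
    change (T (-M) * f) • (T a : Laurent) • x ∈ G₀ at this
    rwa [smul_smul, mul_right_comm, ← T_add, mul_smul] at this

theorem exists_basis (h : D.IsLattice G₀) :
    ∃ (ι : Type u) (e : Module.Basis ι Laurent G), ∀ g ∈ G₀, g ∈ monomialSpan e {p | p.2 ≤ 0} := by
  obtain ⟨⟨κ, b⟩⟩ := h.free.exists_basis
  have hb : Submodule.span PolyTheta (Set.range fun i => (b i : G)) = G₀ := by
    have := congrArg (Submodule.map G₀.subtype) b.span_eq
    rw [Submodule.map_span, ← Set.range_comp, Submodule.map_subtype_top] at this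
    exact this
  have hli₀ : LinearIndependent PolyTheta fun i => (b i : G) :=
    b.linearIndependent.map_injOn G₀.subtype Subtype.val_injective.injOn
  have hli : LinearIndependent Laurent fun i => (b i : G) :=
    linearIndependent_of_polyTheta hli₀
  have hsp : ⊤ ≤ Submodule.span Laurent (Set.range fun i => (b i : G)) := by
    rw [← h.span_eq_top, Submodule.span_le]
    intro g hg
    rw [← hb] at hg
    exact Submodule.span_le_restrictScalars PolyTheta Laurent _ hg
  refine ⟨κ, Module.Basis.mk hli hsp, fun g hg => ?_⟩
  have hst : ∀ g ∈ monomialSpan (Module.Basis.mk hli hsp) {p | p.2 ≤ 0},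
      theta • g ∈ monomialSpan (Module.Basis.mk hli hsp) {p | p.2 ≤ 0} := fun g hg =>
    T_smul_mem_monomialSpan_of_mem (fun i m (hm : m ≤ 0) => show -1 + m ≤ 0 by omega) hg
  have : G₀ ≤ adjoinSubmodule _ hst := by
    conv_lhs => rw [← hb]
    rw [Submodule.span_le]
    rintro _ ⟨i, rfl⟩
    have := T_smul_mem_monomialSpan (Module.Basis.mk hli hsp) (P := {p | p.2 ≤ 0}) (i := i)
      (m := 0) (by simp)
    rw [T_zero, one_smul, Module.Basis.mk_apply] at this
    exact this
  exact this hg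

/-- In a basis coming from the lattice, elements of `G₀` have exponents of `τ` at most `0`. Those of
`V_0`, being of finite type, have exponents bounded below, hence those of `V_{-d} = τᵈV_0` have
positive exponents for large `d`. -/
theorem exists_forall_eq_zero (h : D.IsLattice G₀) {V : ℚ → Submodule PolyTau G}
    (hV : D.IsLogFiltration V) : ∃ d : ℕ, ∀ g ∈ V (-d), g ∈ G₀ → g = 0 := by
  obtain ⟨ι, e, he⟩ := h.exists_basis
  obtain ⟨S, hS⟩ := hV.fg
  have hst : ∀ M : ℤ, ∀ g ∈ monomialSpan e {p | M ≤ p.2},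
      tau • g ∈ monomialSpan e {p | M ≤ p.2} := fun M g hg =>
    T_smul_mem_monomialSpan_of_mem (fun i m (hm : M ≤ m) => show M ≤ 1 + m by omega) hg
  obtain ⟨M, hM⟩ : ∃ M : ℤ, ∀ g ∈ S, g ∈ monomialSpan e {p | M ≤ p.2} := by
    classical
    obtain ⟨M, hM⟩ := (S.biUnion fun g =>
      ((monomialBasis e).repr g).support.image Prod.snd).bddBelow
    refine ⟨M, fun g hg => mem_monomialSpan_iff.2 fun p hp => ?_⟩
    refine hM ?_
    simp only [Finset.coe_biUnion, Set.mem_iUnion]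
    exact ⟨g, hg, Finset.mem_coe.2 (Finset.mem_image_of_mem _ hp)⟩
  have hV0 : V 0 ≤ adjoinSubmodule _ (hst M) := by
    rw [← hS, Submodule.span_le]
    exact hM
  obtain ⟨d, hd⟩ : ∃ d : ℕ, 1 - M ≤ d := ⟨_, Int.self_le_toNat _⟩
  refine ⟨d, fun g hg hg₀ => ?_⟩
  have h1 := hV0 (hV.T_smul_mem (-d) hg (γ := 0) (by simp))
  have h2 : g ∈ monomialSpan e {p | 1 ≤ p.2} := by
    rw [← T_smul_T_neg_smul d g]
    exact T_smul_mem_monomialSpan_of_mem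
      (fun i m (hm : M ≤ m) => show 1 ≤ (d : ℤ) + m by omega) h1
  have h3 : g ∈ monomialSpan e ({p | 1 ≤ p.2} ∩ {p | p.2 ≤ 0}) := by
    rw [← monomialSpan_inter]
    exact ⟨h2, he g hg₀⟩
  have h4 : ({p | 1 ≤ p.2} ∩ {p | p.2 ≤ 0} : Set (ι × ℤ)) = ∅ := by
    ext p
    simp only [Set.mem_inter_iff, Set.mem_ofPred_eq, Set.mem_empty_iff_false, iff_false]
    omega
  rw [h4, monomialSpan, Set.image_empty, Submodule.span_empty] at h3
  exact h3

end Connection.IsLattice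

/-- Representatives in `A` of a basis of the image of `A` modulo `K`. -/
theorem exists_basis_mod {E : Type u} [AddCommGroup E] [Module ℂ E] (A K : Submodule ℂ E) :
    ∃ (ι : Type u) (e : ι → E), (∀ i, e i ∈ A) ∧
      (∀ g ∈ A, ∃ u ∈ Submodule.span ℂ (Set.range e), g - u ∈ K) ∧
      ∀ c : ι →₀ ℂ, Finsupp.linearCombination ℂ e c ∈ K → c = 0 := by
  let B := Module.Basis.ofVectorSpace ℂ (A ⧸ K.submoduleOf A)
  choose e he using fun i => (K.submoduleOf A).mkQ_surjective (B i)
  have hcomp : ∀ c, (K.submoduleOf A).mkQ (Finsupp.linearCombination ℂ e c) =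
      Finsupp.linearCombination ℂ B c := fun c => by
    rw [Finsupp.apply_linearCombination]
    congr 2
    exact funext he
  have hcoe : ∀ c, ((Finsupp.linearCombination ℂ e c : A) : E) =
      Finsupp.linearCombination ℂ (fun i => (e i : E)) c := fun c =>
    Finsupp.apply_linearCombination ℂ A.subtype e c
  refine ⟨Module.Basis.ofVectorSpaceIndex ℂ (A ⧸ K.submoduleOf A), fun i => (e i : E), fun i => (e i).2, fun g hg => ?_, fun c hc => ?_⟩
  · set c := B.repr ((K.submoduleOf A).mkQ ⟨g, hg⟩) with hc
    refine ⟨_, (Finsupp.mem_span_range_iff_exists_finsupp).2 ⟨c, rfl⟩, ?_⟩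
    have h1 := hcomp c
    rw [hc, B.linearCombination_repr, ← hc, eq_comm, ← sub_eq_zero, ← map_sub,
      Submodule.mkQ_apply, Submodule.Quotient.mk_eq_zero] at h1
    have h2 : g - ((Finsupp.linearCombination ℂ e c : A) : E) ∈ K := h1
    rw [hcoe] at h2
    exact h2
  · rw [← hcoe] at hc
    have h1 : (K.submoduleOf A).mkQ (Finsupp.linearCombination ℂ e c) = 0 := by
      rw [Submodule.mkQ_apply, Submodule.Quotient.mk_eq_zero]
      exact hc
    rw [hcomp] at h1
    exact (linearIndependent_iff.1 B.linearIndependent) c h1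

/-- Vectors of a `ℂ[θ]`-submodule `S` which are independent modulo `θS` are independent over
`ℂ[τ, τ⁻¹]`. -/
theorem linearIndependent_of_mod_theta {ι : Type*} (S : Submodule PolyTheta G) {e : ι → G}
    (he : ∀ i, e i ∈ S)
    (h : ∀ c : ι →₀ ℂ, (T 1 : Laurent) • Finsupp.linearCombination ℂ e c ∈ S → c = 0) :
    LinearIndependent Laurent e := by
  rw [linearIndependent_iff]
  intro f hf
  obtain ⟨M, hM⟩ : ∃ M : ℤ, ∀ i n, M < n → (f i).coeff n = 0 := by
    classical
    obtain ⟨M, hM⟩ := (f.support.biUnion fun i => (f i).coeff.support).bddAbove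
    refine ⟨M, fun i n hn => ?_⟩
    by_contra hne
    refine absurd (hM (Finset.mem_coe.2 (Finset.mem_biUnion.2
      ⟨i, Finsupp.mem_support_iff.2 fun h0 => hne ?_, Finsupp.mem_support_iff.2 hne⟩))) (not_le.2 hn)
    rw [h0, AddMonoidAlgebra.coeff_zero, Finsupp.zero_apply]
  -- The coefficients of the relation are killed from the highest power of `τ` downwards.
  have key : ∀ d : ℕ, ∀ i n, M - d < n → (f i).coeff n = 0 := by
    intro d
    induction d with
    | zero => simpa using hM
    | succ d ih =>
      set m : ℤ := M - d with hm
      let c : ι →₀ ℂ := f.mapRange (fun p => p.coeff m) rfl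
      have hc : c = 0 := by
        apply h
        -- Multiplication by `τ^(1-m)` moves the leading coefficients to exponent `1`. All lower
        -- terms fall into `S`, so the relation says that `∑ cᵢ eᵢ ∈ θS`.
        have h1 : (T (1 - m) : Laurent) • Finsupp.linearCombination Laurent e f -
            (T 1 : Laurent) • Finsupp.linearCombination ℂ e c ∈ S := by
          have hsum : Finsupp.linearCombination ℂ e c = ∑ i ∈ f.support, (f i).coeff m • e i := by
            rw [Finsupp.linearCombination_apply]
            exact Finsupp.sum_mapRange_index (by simp)
          rw [Finsupp.linearCombination_apply, hsum, Finsupp.sum, Finset.smul_sum,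
            Finset.smul_sum, ← Finset.sum_sub_distrib]
          refine sum_mem fun i _ => ?_
          have h2 : T (1 - m) * f i - (f i).coeff m • T 1 ∈ PolyTheta := by
            refine mem_polyTheta_of_coeff fun n hn => ?_
            rw [AddMonoidAlgebra.coeff_sub, Finsupp.sub_apply, coeff_T_mul,
              AddMonoidAlgebra.coeff_smul, Finsupp.smul_apply, T_apply]
            rcases eq_or_ne 1 n with rfl | hne
            · rw [if_pos rfl, show (1 : ℤ) - (1 - m) = m by ring]
              simp
            · rw [if_neg hne, ih i _ (by omega)]
              simp
          have h3 := S.smul_mem ⟨_, h2⟩ (he i)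
          change (T (1 - m) * f i - (f i).coeff m • T 1) • e i ∈ S at h3
          rw [sub_smul, smul_assoc, mul_smul] at h3
          rwa [smul_comm (T 1 : Laurent)]
        rw [hf, smul_zero, zero_sub] at h1
        exact neg_mem_iff.1 h1
      intro i n hn
      rcases eq_or_lt_of_le (show m ≤ n by push_cast at hn; omega) with rfl | hlt
      · exact DFunLike.congr_fun hc i
      · exact ih i n hlt
  ext i n
  exact key (M - n + 1).toNat i n (by omega)

/-- A form, indexed by `ℤ`, of the splitting of a filtration by `ℂ[τ]`-lattices and a `ℂ[θ]`-lattice. -/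
theorem exists_adapted_basis [Module.Finite Laurent G] (F : ℤ → Submodule ℂ G)
    (S : Submodule PolyTheta G) {N : ℕ} (hN : 0 < N) (mono : Monotone F)
    (exhaustive : ∀ g, ∃ n, g ∈ F n)
    (hT : ∀ (m n : ℤ) (g : G), g ∈ F n → (T m : Laurent) • g ∈ F (n - N * m))
    (hbot : ∃ n₀, ∀ g ∈ F n₀, g ∈ S → g = 0) (hgen : ∀ g : G, ∃ k : ℤ, (T k : Laurent) • g ∈ S) :
    ∃ (r : ℕ) (e : Module.Basis (Fin r) Laurent G) (a : Fin r → ℤ),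
      (∀ n g, g ∈ F n ↔ g ∈ monomialSpan e {p | a p.1 - N * p.2 ≤ n}) ∧
      ∀ g, g ∈ S ↔ g ∈ monomialSpan e {p | p.2 ≤ 0} := by
  obtain ⟨n₀, hn₀⟩ := hbot
  have hNz : (0 : ℤ) < N := by exact_mod_cast hN
  let Sc : Submodule ℂ G := S.restrictScalars ℂ
  -- `S₁` is `θS`, written as the set of `g` with `τg ∈ S`.
  let S₁ : Submodule ℂ G := Sc.comap ((LinearMap.lsmul Laurent G (T 1)).restrictScalars ℂ)
  have hS₁S : S₁ ≤ Sc := fun g hg => by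
    have := T_smul_mem_of_polyTheta S (n := -1) (by omega) hg
    rwa [LinearMap.restrictScalars_apply, LinearMap.lsmul_apply, T_neg_smul_T_smul] at this
  choose κ v hvA hvspan hvind using fun n : ℤ =>
    exists_basis_mod (F n ⊓ Sc) ((F n ⊓ S₁) ⊔ (F (n - 1) ⊓ Sc))
  let ι := Σ n : ℤ, κ n
  let e : ι → G := fun i => v i.1 i.2
  let a : ι → ℤ := fun i => i.1
  have heF : ∀ i, e i ∈ F (a i) := fun i => (hvA i.1 i.2).1
  have heS : ∀ i, e i ∈ S := fun i => (hvA i.1 i.2).2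
  let W : ℤ → Submodule ℂ G := fun n => monomialSpan e {p | a p.1 - N * p.2 ≤ n ∧ p.2 ≤ 0}
  -- Induction from `F n₀ ∩ S = 0`. Modulo the chosen representatives, an element of `F n ∩ S` is `x
  -- + y` with `τx ∈ F (n - N) ∩ S` and `y ∈ F (n - 1) ∩ S`; since `N > 0`, both indices are
  -- smaller.
  have hspan : ∀ (d : ℕ) (n : ℤ), n ≤ n₀ + d → ∀ g ∈ F n, g ∈ S → g ∈ W n := by
    intro d
    induction d with
    | zero =>
      intro n hn g hg hgS
      rw [hn₀ g (mono (by simpa using hn) hg) hgS]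
      exact zero_mem _
    | succ d ih =>
      intro n hn g hg hgS
      have hWmono : W (n - 1) ≤ W n := monomialSpan_mono e fun p hp => ⟨by
        have := hp.1
        omega, hp.2⟩
      obtain ⟨u, hu, hgu⟩ := hvspan n g ⟨hg, hgS⟩
      obtain ⟨x, hx, y, hy, hxy⟩ := Submodule.mem_sup.1 hgu
      have hgeq : g = u + (x + y) := by rw [hxy]; abel
      rw [hgeq]
      refine add_mem ?_ (add_mem ?_ ?_)
      · have hle : Submodule.span ℂ (Set.range (v n)) ≤ W n := by
          rw [Submodule.span_le]
          rintro _ ⟨i, rfl⟩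
          have := T_smul_mem_monomialSpan e (P := {p | a p.1 - N * p.2 ≤ n ∧ p.2 ≤ 0})
            (i := ⟨n, i⟩) (m := 0) ⟨by simp [a], le_rfl⟩
          rwa [T_zero, one_smul] at this
        exact hle hu
      · have h1 := hT 1 n x hx.1
        rw [mul_one] at h1
        have h2 := ih (n - N) (by push_cast at hn; omega) _ h1 hx.2
        rw [← T_neg_smul_T_smul 1 x]
        refine T_smul_mem_monomialSpan_of_mem (fun i m hm => ?_) h2
        obtain ⟨h3, h4⟩ := hm
        refine ⟨?_, by omega⟩
        dsimp only at h3 ⊢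
        rw [mul_add]
        omega
      · exact hWmono (ih (n - 1) (by push_cast at hn; omega) y hy.1 hy.2)
  have hspan' : ∀ n, ∀ g ∈ F n, g ∈ S → g ∈ W n := fun n =>
    hspan (n - n₀).toNat n (by omega)
  -- In a relation modulo `θS`, the part of highest weight `n` lies in `(F n ∩ θS) + (F (n - 1) ∩
  -- S)`, so it vanishes by the choice of the representatives of weight `n`.
  have hind : ∀ c : ι →₀ ℂ, (T 1 : Laurent) • Finsupp.linearCombination ℂ e c ∈ S → c = 0 := by
    intro c hc
    by_contra hne
    classical
    obtain ⟨j, hj, hmax⟩ := c.support.exists_max_image a (Finsupp.support_nonempty_iff.2 hne)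
    set n := a j with hn
    set c₁ := c.filter fun i => a i = n with hc₁
    set c₂ := c.filter fun i => ¬ a i = n with hc₂
    have hsum : c₁ + c₂ = c := Finsupp.filter_add_filter_not c _
    have hmem : ∀ (b : ι →₀ ℂ) (M : Submodule ℂ G), (∀ i ∈ b.support, e i ∈ M) →
        Finsupp.linearCombination ℂ e b ∈ M := fun b M hb => by
      rw [Finsupp.linearCombination_apply]
      exact sum_mem fun i hi => M.smul_mem _ (hb i hi)
    have h₂ : Finsupp.linearCombination ℂ e c₂ ∈ F (n - 1) ⊓ Sc := by
      refine hmem _ _ fun i hi => ⟨?_, heS i⟩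
      rw [hc₂, Finsupp.support_filter, Finset.mem_filter] at hi
      have := hmax i hi.1
      exact mono (by omega) (heF i)
    have h₀ : Finsupp.linearCombination ℂ e c ∈ F n ⊓ S₁ :=
      ⟨hmem _ _ fun i hi => mono (hmax i hi) (heF i), hc⟩
    have h₁ : Finsupp.linearCombination ℂ e c₁ ∈ (F n ⊓ S₁) ⊔ (F (n - 1) ⊓ Sc) := by
      have : Finsupp.linearCombination ℂ e c₁ =
          Finsupp.linearCombination ℂ e c - Finsupp.linearCombination ℂ e c₂ := by
        rw [← map_sub, ← hsum, add_sub_cancel_right]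
      rw [this]
      exact sub_mem (Submodule.mem_sup_left h₀) (Submodule.mem_sup_right h₂)
    have hinj : Function.Injective (Sigma.mk n : κ n → ι) := sigma_mk_injective
    have hc₁' : Finsupp.mapDomain (Sigma.mk n) (Finsupp.comapDomain (Sigma.mk n) c₁ hinj.injOn) =
        c₁ := by
      refine Finsupp.mapDomain_comapDomain _ hinj c₁ ?_
      rintro ⟨m, i⟩ hi
      rw [hc₁, Finsupp.support_filter, Finset.mem_coe, Finset.mem_filter] at hi
      obtain ⟨-, rfl⟩ := hi
      exact ⟨i, rfl⟩
    rw [← hc₁', Finsupp.linearCombination_mapDomain] at h₁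
    have h₃ := hvind n _ h₁
    rw [h₃, Finsupp.mapDomain_zero] at hc₁'
    have h₄ : c₁ j = c j := Finsupp.filter_apply_pos _ _ rfl
    rw [← hc₁', Finsupp.zero_apply] at h₄
    exact (Finsupp.mem_support_iff.1 hj) h₄.symm
  have hli := linearIndependent_of_mod_theta S heS hind
  -- A power of `τ` moves `g` into `S`, where `hspan'` applies; moving back translates the weights
  -- by the same amount.
  have hdesc : ∀ n, ∀ g ∈ F n, g ∈ monomialSpan e {p | a p.1 - N * p.2 ≤ n} := by
    intro n g hg
    obtain ⟨k, hk⟩ := hgen g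
    have h1 := hspan' _ _ (hT k n g hg) hk
    rw [← T_neg_smul_T_smul k g]
    refine T_smul_mem_monomialSpan_of_mem (fun i m hm => ?_) h1
    have h3 : a i - N * m ≤ n - N * k := hm.1
    change a i - N * (-k + m) ≤ n
    rw [mul_add]
    linarith
  have htop : ⊤ ≤ Submodule.span Laurent (Set.range e) := by
    intro g _
    obtain ⟨n, hn⟩ := exhaustive g
    have hle : monomialSpan e {p | a p.1 - N * p.2 ≤ n} ≤
        (Submodule.span Laurent (Set.range e)).restrictScalars ℂ :=
      monomialSpan_le.2 fun i m _ => Submodule.smul_mem _ _ (Submodule.subset_span (Set.mem_range_self i))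
    exact hle (hdesc n g hn)
  let B := Module.Basis.mk hli htop
  have : Finite ι := Module.Finite.finite_basis B
  obtain ⟨r, ⟨σ⟩⟩ := Finite.exists_equiv_fin ι
  have hreindex : ∀ (Q : ι × ℤ → Prop), monomialSpan (B.reindex σ) {p | Q (σ.symm p.1, p.2)} =
      monomialSpan e {p | Q p} := by
    intro Q
    apply le_antisymm
    · refine monomialSpan_le.2 fun i m hm => ?_
      rw [Module.Basis.reindex_apply, Module.Basis.mk_apply]
      exact T_smul_mem_monomialSpan e hm
    · refine monomialSpan_le.2 fun i m hm => ?_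
      have := T_smul_mem_monomialSpan (B.reindex σ) (P := {p | Q (σ.symm p.1, p.2)}) (i := σ i)
        (m := m) (by simpa using hm)
      rwa [Module.Basis.reindex_apply, Module.Basis.mk_apply, Equiv.symm_apply_apply] at this
  refine ⟨r, B.reindex σ, fun i => a (σ.symm i), fun n g => ?_, fun g => ?_⟩
  · rw [hreindex fun p => a p.1 - N * p.2 ≤ n]
    refine ⟨hdesc n g, fun hg => ?_⟩
    have hle : monomialSpan e {p | a p.1 - N * p.2 ≤ n} ≤ F n :=
      monomialSpan_le.2 fun i m hm => mono hm (hT m _ _ (heF i))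
    exact hle hg
  · rw [hreindex fun p => p.2 ≤ 0]
    refine ⟨fun hg => ?_, fun hg => ?_⟩
    · obtain ⟨n, hn⟩ := exhaustive g
      exact monomialSpan_mono e (fun p hp => hp.2) (hspan' n g hn hg)
    · have hle : monomialSpan e {p | p.2 ≤ 0} ≤ Sc :=
        monomialSpan_le.2 fun i m hm => T_smul_mem_of_polyTheta S hm (heS i)
      exact hle hg

end Lattices

end MeroConn

namespace MeroConn

open LaurentPolynomial

/-! ### The spectrum as the multiset of weights; filtrations defined by weights -/

section Split

variable {G : Type*} [AddCommGroup G] [Module ℂ G] [Module Laurent G] [IsScalarTower ℂ Laurent G]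
variable {ι : Type*}

/-- The filtration `V` and the lattice `G₀` are split by the basis `e`, whose members have the
weights `a`: one has `V_β = ⨁ τᵐ eᵢ ℂ` over `aᵢ - m ≤ β`, and `G₀ = ⨁ ℂ[θ] eᵢ`. -/
structure IsSplitBy (V : ℚ → Submodule PolyTau G) (G₀ : Submodule PolyTheta G)
    (e : Module.Basis ι Laurent G) (a : ι → ℚ) : Prop where
  mem_filtration : ∀ β g, g ∈ V β ↔ g ∈ monomialSpan e {p | a p.1 - p.2 ≤ β}
  mem_lattice : ∀ g, g ∈ G₀ ↔ g ∈ monomialSpan e {p | p.2 ≤ 0}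

theorem Connection.IsLogFiltration.exists_isSplitBy [Module.Finite Laurent G] {D : Connection G}
    {V : ℚ → Submodule PolyTau G} (hV : D.IsLogFiltration V) {G₀ : Submodule PolyTheta G}
    (hL : D.IsLattice G₀) :
    ∃ (r : ℕ) (e : Module.Basis (Fin r) Laurent G) (a : Fin r → ℚ), IsSplitBy V G₀ e a := by
  obtain ⟨N, hN, hj⟩ := hV.jumps
  have hNq : (0 : ℚ) < N := by exact_mod_cast hN
  obtain ⟨d, hd⟩ := hL.exists_forall_eq_zero hV
  obtain ⟨r, e, a, hF, hS⟩ := exists_adapted_basis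
    (fun n : ℤ => (V (n / N)).restrictScalars ℂ) G₀ hN
    (fun m n h => hV.mono (div_le_div_of_nonneg_right (by exact_mod_cast h) hNq.le))
    (fun g => by
      obtain ⟨β, hβ⟩ := hV.exhaustive g
      rw [hj] at hβ
      exact ⟨_, hβ⟩)
    (fun m n g hg => hV.T_smul_mem m hg (by push_cast; field_simp; exact le_rfl))
    ⟨-(N * d : ℕ), fun g hg => hd g (by
      have hg' : g ∈ V ((-(N * d : ℕ) : ℤ) / N) := hg
      convert hg' using 2
      push_cast
      field_simp)⟩ hL.exists_T_smul_mem
  refine ⟨r, e, fun i => a i / N, fun β g => ?_, hS⟩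
  rw [hj]
  refine (hF ⌊(N : ℚ) * β⌋ g).trans ?_
  have : ({p | a p.1 - N * p.2 ≤ ⌊(N : ℚ) * β⌋} : Set (Fin r × ℤ)) =
      {p | (a p.1 : ℚ) / N - p.2 ≤ β} := by
    ext p
    simp only [Set.mem_ofPred_eq]
    rw [Int.le_floor, div_sub' hNq.ne', div_le_iff₀' hNq]
    push_cast
    rfl
  rw [this]

theorem mem_latticeShift_neg_one {G₀ : Submodule PolyTheta G} {g : G} :
    g ∈ latticeShift G₀ (-1) ↔ (T 1 : Laurent) • g ∈ G₀ := by
  refine Submodule.mem_map.trans ⟨?_, fun h => ⟨_, h, T_neg_smul_T_smul 1 g⟩⟩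
  rintro ⟨h, hh, rfl⟩
  change (T 1 : Laurent) • (T (-1) : Laurent) • h ∈ G₀
  rwa [T_smul_T_neg_smul 1 h]

theorem finrank_monomialSpan (e : Module.Basis ι Laurent G) (S : Set (ι × ℤ)) (hS : S.Finite) :
    Module.finrank ℂ (monomialSpan e S) = S.ncard := by
  have := hS.fintype
  have h1 := finrank_span_eq_card ((monomialBasis e).linearIndependent.comp
    (Subtype.val : S → ι × ℤ) Subtype.val_injective)
  rw [Set.range_comp, Subtype.range_coe, ← monomialSpan_eq] at h1
  rw [h1, ← Nat.card_eq_fintype_card, ← Nat.card_coe_set_eq]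

theorem finrank_monomialSpan_quotient (e : Module.Basis ι Laurent G) {S S' : Set (ι × ℤ)}
    (h : S' ⊆ S) (hS : S.Finite) :
    Module.finrank ℂ (monomialSpan e S ⧸ (monomialSpan e S').submoduleOf (monomialSpan e S)) =
      (S \ S').ncard := by
  have hfin : Module.Finite ℂ (monomialSpan e S) :=
    FiniteDimensional.span_of_finite ℂ (hS.image _)
  have h1 := Submodule.finrank_quotient_add_finrank
    ((monomialSpan e S').submoduleOf (monomialSpan e S))
  rw [(Submodule.submoduleOfEquivOfLe (monomialSpan_mono e h)).finrank_eq,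
    finrank_monomialSpan e S hS, finrank_monomialSpan e S' (hS.subset h)] at h1
  rw [Set.ncard_sdiff h (hS.subset h)]
  omega

/-- All four subspaces in the definition of `ν_β` are spanned by monomials, so the dimension is the
number of monomials in a difference of index sets. -/
theorem IsSplitBy.nu_eq [Fintype ι] {D : Connection G} {V : ℚ → Submodule PolyTau G}
    {G₀ : Submodule PolyTheta G} {e : Module.Basis ι Laurent G} {a : ι → ℚ}
    (h : IsSplitBy V G₀ e a) (hV : D.IsLogFiltration V) (β : ℚ) :
    D.nu G₀ β = (Finset.univ.filter fun i => a i = β).card := by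
  have hVβ : (V β).restrictScalars ℂ = monomialSpan e {p | a p.1 - p.2 ≤ β} := by
    ext g
    exact h.mem_filtration β g
  have hL : G₀.restrictScalars ℂ = monomialSpan e {p | p.2 ≤ 0} := by
    ext g
    exact h.mem_lattice g
  have hL₁ : (latticeShift G₀ (-1)).restrictScalars ℂ = monomialSpan e {p | p.2 ≤ -1} := by
    ext g
    refine mem_latticeShift_neg_one.trans ((h.mem_lattice _).trans ⟨fun hg => ?_, fun hg => ?_⟩)
    · rw [← T_neg_smul_T_smul 1 g]
      exact T_smul_mem_monomialSpan_of_mem (fun i m (hm : m ≤ 0) => show -1 + m ≤ -1 by omega) hg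
    · exact T_smul_mem_monomialSpan_of_mem (fun i m (hm : m ≤ -1) => show 1 + m ≤ 0 by omega) hg
  have hVlt : (VLt V β).restrictScalars ℂ = monomialSpan e {p | a p.1 - p.2 < β} := by
    apply le_antisymm
    · have hst : ∀ g ∈ monomialSpan e {p | a p.1 - p.2 < β},
          tau • g ∈ monomialSpan e {p | a p.1 - p.2 < β} := fun g hg =>
        T_smul_mem_monomialSpan_of_mem (fun i m (hm : a i - m < β) =>
          show a i - ((1 + m : ℤ) : ℚ) < β by push_cast; linarith) hg
      have : VLt V β ≤ adjoinSubmodule _ hst := VLt_le fun γ hγ g hg =>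
        monomialSpan_mono e (fun p hp => lt_of_le_of_lt hp hγ) ((h.mem_filtration γ g).1 hg)
      exact this
    · refine monomialSpan_le.2 fun i m hm => ?_
      exact le_VLt V hm ((h.mem_filtration _ _).2 (T_smul_mem_monomialSpan e (le_refl (a i - m))))
  change Module.finrank ℂ (↥((D.vFiltration β).restrictScalars ℂ ⊓ G₀.restrictScalars ℂ) ⧸
    (((D.vFiltration β).restrictScalars ℂ ⊓ (latticeShift G₀ (-1)).restrictScalars ℂ) ⊔
      ((VLt D.vFiltration β).restrictScalars ℂ ⊓ G₀.restrictScalars ℂ)).submoduleOf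
      ((D.vFiltration β).restrictScalars ℂ ⊓ G₀.restrictScalars ℂ)) = _
  rw [hV.vFiltration_eq, hVβ, hL, hL₁, hVlt, monomialSpan_inter, monomialSpan_inter,
    monomialSpan_inter, monomialSpan_union, finrank_monomialSpan_quotient]
  -- Excluding `G_{-1}` forces the exponent `0`, and then excluding `V_{<β}` forces the weight `β`.
  · have : (({p | a p.1 - p.2 ≤ β} ∩ {p | p.2 ≤ 0}) \ ({p | a p.1 - p.2 ≤ β} ∩ {p | p.2 ≤ -1} ∪
        {p | a p.1 - p.2 < β} ∩ {p | p.2 ≤ 0}) : Set (ι × ℤ)) =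
        (fun i => (i, (0 : ℤ))) '' (Finset.univ.filter fun i => a i = β : Finset ι) := by
      ext ⟨i, m⟩
      simp only [Set.mem_sdiff, Set.mem_inter_iff, Set.mem_ofPred_eq, Set.mem_union, Set.mem_image,
        Finset.coe_filter, Finset.mem_univ, true_and, Prod.mk.injEq]
      constructor
      · rintro ⟨⟨h1, h2⟩, h3⟩
        push Not at h3
        have hm : m = 0 := by
          have := h3.1 h1
          omega
        subst hm
        refine ⟨i, ?_, rfl, rfl⟩
        rw [Int.cast_zero, sub_zero] at h1
        by_contra hne
        have := h3.2 (by rw [Int.cast_zero, sub_zero]; exact lt_of_le_of_ne h1 hne)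
        omega
      · rintro ⟨j, h1, rfl, rfl⟩
        rw [Int.cast_zero, sub_zero]
        exact ⟨⟨h1.le, le_rfl⟩, by simp [h1]⟩
    rw [this, Set.ncard_image_of_injective _ (fun i j h => (Prod.mk.inj h).1), Set.ncard_coe_finset]
  · rintro p (⟨h1, h2⟩ | ⟨h1, h2⟩)
    · exact ⟨h1, le_trans (show p.2 ≤ -1 from h2) (by norm_num)⟩
    · exact ⟨le_of_lt (show a p.1 - p.2 < β from h1), h2⟩
  · have : ∀ i : ι, {m : ℤ | a i - m ≤ β ∧ m ≤ 0}.Finite := fun i =>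
      (Set.finite_Icc ⌈a i - β⌉ 0).subset fun m hm =>
        ⟨Int.ceil_le.2 (by have := hm.1; linarith), hm.2⟩
    refine (Set.finite_iUnion fun i => (this i).image (Prod.mk i)).subset ?_
    rintro ⟨i, m⟩ ⟨h1, h2⟩
    exact Set.mem_iUnion.2 ⟨i, m, ⟨h1, h2⟩, rfl⟩

/-- A logarithmic filtration makes the connection regular with quasi-unipotent monodromy. -/
theorem Connection.IsLogFiltration.isRegularQuasiUnipotent {D : Connection G}
    {V : ℚ → Submodule PolyTau G} (hV : D.IsLogFiltration V) : D.IsRegularQuasiUnipotent := by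
  refine ⟨V 0, ⟨hV.fg, eq_top_iff.2 fun g _ => ?_, hV.tauD_mem 0⟩, fun c hc => ?_⟩
  · obtain ⟨β, hβ⟩ := hV.exhaustive g
    obtain ⟨n, hn⟩ := exists_nat_ge β
    rw [← T_neg_smul_T_smul n g]
    exact Submodule.smul_mem _ _ (Submodule.subset_span
      (hV.T_smul_mem n hβ (by push_cast; linarith)))
  · obtain ⟨g, hg, hng, h, hh, hgh⟩ := hc
    by_contra hq
    push Not at hq
    obtain ⟨N, hN, hj⟩ := hV.jumps
    obtain ⟨P, hP, hPx⟩ := D.exists_aeval_mem_of_nilpotent hV.mono hN hj hV.nilpotent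
      (show (-1 : ℚ) ≤ 0 by norm_num)
    -- The polynomial `P` has rational roots and sends `V_0` into `V_{-1} = τV_0`. A residue
    -- eigenvalue `c` that is not rational would make `P` and `X - c` coprime, forcing `g` into
    -- `τV_0`.
    have h1 : g ∈ V (-1) := by
      refine mem_of_aeval_apply_mem_of_no_common_root (M := (V (-1)).restrictScalars ℂ)
        (hV.tauD_mem _) (hP g hg) (Q := Polynomial.X - Polynomial.C c) ?_ fun x hx hx' => ?_
      · rw [map_sub, Polynomial.aeval_X, Polynomial.aeval_C, LinearMap.sub_apply,
          Module.algebraMap_end_apply, hgh]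
        exact hV.T_smul_mem 1 hh (by norm_num)
      · obtain ⟨γ, -, -, rfl⟩ := hPx x hx
        rw [Polynomial.eval_sub, Polynomial.eval_X, Polynomial.eval_C, sub_eq_zero] at hx'
        exact hq (-γ) (by rw [← hx']; push_cast; rfl)
    exact hng ⟨(T (-1) : Laurent) • g, hV.T_smul_mem (-1) h1 (by norm_num),
      (T_smul_T_neg_smul 1 g).symm⟩

/-- The `ℂ[τ]`-submodule spanned by the `τᵐ eᵢ` with `aᵢ - m ≤ β`. -/
noncomputable def monomialFiltration (e : ι → G) (a : ι → ℚ) (β : ℚ) : Submodule PolyTau G :=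
  adjoinSubmodule (monomialSpan e {p | a p.1 - p.2 ≤ β}) fun _ hg =>
    T_smul_mem_monomialSpan_of_mem (fun i m (hm : a i - m ≤ β) =>
      show a i - ((1 + m : ℤ) : ℚ) ≤ β by push_cast; linarith) hg

theorem monomialFiltration_mono (e : ι → G) (a : ι → ℚ) : Monotone (monomialFiltration e a) :=
  fun _ _ h _ hg => monomialSpan_mono e (fun _ hp => le_trans hp h) hg

theorem T_smul_mem_monomialFiltration {e : ι → G} {a : ι → ℚ} (m : ℤ) {β : ℚ} {g : G}
    (hg : g ∈ monomialFiltration e a β) :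
    (T m : Laurent) • g ∈ monomialFiltration e a (β - m) :=
  T_smul_mem_monomialSpan_of_mem (fun i n (hn : a i - n ≤ β) =>
    show a i - ((m + n : ℤ) : ℚ) ≤ β - m by push_cast; linarith) hg

theorem monomialFiltration_floor [Fintype ι] (e : ι → G) (a : ι → ℚ) :
    ∃ N : ℕ, 0 < N ∧ ∀ β : ℚ,
      monomialFiltration e a β = monomialFiltration e a (⌊N * β⌋ / N) := by
  have hN : 0 < ∏ i, (a i).den := Finset.prod_pos fun i _ => (a i).den_pos
  refine ⟨∏ i, (a i).den, hN, fun β => ?_⟩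
  set N := ∏ i, (a i).den
  have hN' : (0 : ℚ) < N := by exact_mod_cast hN
  apply le_antisymm
  · intro g hg
    refine monomialSpan_mono e (fun p hp => ?_) hg
    obtain ⟨c, hc⟩ : (a p.1).den ∣ N := Finset.dvd_prod_of_mem (fun i => (a i).den)
      (Finset.mem_univ p.1)
    have e : (N : ℚ) * (a p.1 - p.2) = ((a p.1).num * c - N * p.2 : ℤ) := by
      have : ((a p.1).den : ℚ) * a p.1 = (a p.1).num := Rat.den_mul_eq_num _
      rw [mul_sub]
      nth_rw 1 [hc]
      push_cast
      rw [← this]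
      ring
    have hp' : a p.1 - p.2 ≤ β := hp
    change a p.1 - p.2 ≤ ⌊(N : ℚ) * β⌋ / N
    rw [le_div_iff₀' hN', e]
    have h2 : (N : ℚ) * (a p.1 - p.2) ≤ N * β := by gcongr
    rw [e] at h2
    exact_mod_cast Int.le_floor.2 h2
  · refine monomialFiltration_mono e a ?_
    rw [div_le_iff₀' hN']
    exact Int.floor_le _

theorem exists_mem_monomialFiltration (e : Module.Basis ι Laurent G) [Fintype ι] (a : ι → ℚ)
    (g : G) : ∃ β, g ∈ monomialFiltration e a β := by
  classical
  obtain ⟨β, hβ⟩ := (((monomialBasis e).repr g).support.image fun p => a p.1 - p.2).bddAbove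
  exact ⟨β, mem_monomialSpan_iff.2 fun p hp =>
    hβ (Finset.mem_coe.2 (Finset.mem_image_of_mem _ hp))⟩

theorem monomialFiltration_fg [Fintype ι] (e : ι → G) (a : ι → ℚ) (β : ℚ) :
    (monomialFiltration e a β).FG := by
  classical
  refine ⟨Finset.univ.image fun i => (T ⌈a i - β⌉ : Laurent) • e i, le_antisymm ?_ ?_⟩
  · rw [Submodule.span_le]
    intro g hg
    obtain ⟨i, -, rfl⟩ := Finset.mem_image.1 (Finset.mem_coe.1 hg)
    refine T_smul_mem_monomialSpan e ?_
    have := Int.le_ceil (a i - β)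
    change a i - (⌈a i - β⌉ : ℚ) ≤ β
    linarith
  · have : monomialSpan e {p | a p.1 - p.2 ≤ β} ≤ (Submodule.span PolyTau
        ((Finset.univ.image fun i => (T ⌈a i - β⌉ : Laurent) • e i : Finset G) :
          Set G)).restrictScalars ℂ := by
      refine monomialSpan_le.2 fun i m hm => ?_
      have hm' : a i - m ≤ β := hm
      have hle : ⌈a i - β⌉ ≤ m := Int.ceil_le.2 (by linarith)
      have h1 : (T ⌈a i - β⌉ : Laurent) • e i ∈ Submodule.span PolyTau
          ((Finset.univ.image fun i => (T ⌈a i - β⌉ : Laurent) • e i : Finset G) : Set G) :=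
        Submodule.subset_span (Finset.mem_coe.2 (Finset.mem_image_of_mem _ (Finset.mem_univ i)))
      have h2 := T_smul_mem_of_polyTau _ (n := m - ⌈a i - β⌉) (by omega) h1
      rwa [T_smul_T_smul, sub_add_cancel] at h2
    exact this

theorem mem_VLt {V : ℚ → Submodule PolyTau G} (mono : Monotone V) {β : ℚ} {g : G} :
    g ∈ VLt V β ↔ ∃ γ < β, g ∈ V γ := by
  have : Nonempty (Set.Iio β) := ⟨⟨β - 1, by simp⟩⟩
  rw [VLt, Submodule.mem_iSup_of_directed _
    (fun γ δ => ⟨max γ δ, mono (le_max_left _ _), mono (le_max_right _ _)⟩)]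
  exact ⟨fun ⟨γ, h⟩ => ⟨γ, γ.2, h⟩, fun ⟨γ, h, h'⟩ => ⟨⟨γ, h⟩, h'⟩⟩

end Split

end MeroConn

namespace MeroConn

open LaurentPolynomial

/-! ### Tensor products of filtrations and lattices -/

section Tensor

variable {G₁ G₂ : Type*}
  [AddCommGroup G₁] [Module ℂ G₁] [Module Laurent G₁] [IsScalarTower ℂ Laurent G₁]
  [AddCommGroup G₂] [Module ℂ G₂] [Module Laurent G₂] [IsScalarTower ℂ Laurent G₂]
  {ι₁ ι₂ : Type*}

theorem T_smul_tmul_T_smul (m n : ℤ) (x : G₁) (y : G₂) :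
    ((T m : Laurent) • x) ⊗ₜ[Laurent] ((T n : Laurent) • y) =
      (T (m + n) : Laurent) • (x ⊗ₜ[Laurent] y) := by
  rw [TensorProduct.smul_tmul_smul, T_add]

theorem complex_smul_tmul (c : ℂ) (x : G₁) (y : G₂) :
    (c • x) ⊗ₜ[Laurent] y = c • (x ⊗ₜ[Laurent] y) :=
  (TensorProduct.smul_tmul' c x y).symm

theorem tmul_complex_smul (c : ℂ) (x : G₁) (y : G₂) :
    x ⊗ₜ[Laurent] (c • y) = c • (x ⊗ₜ[Laurent] y) := by
  rw [← algebraMap_smul Laurent c y, TensorProduct.tmul_smul, algebraMap_smul]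

theorem tmul_mem_monomialSpan {e₁ : ι₁ → G₁} {e₂ : ι₂ → G₂} {P : Set (ι₁ × ℤ)} {Q : Set (ι₂ × ℤ)}
    {e : ι₁ × ι₂ → G₁ ⊗[Laurent] G₂} (he : ∀ i j, e (i, j) = e₁ i ⊗ₜ[Laurent] e₂ j)
    {R : Set ((ι₁ × ι₂) × ℤ)}
    (h : ∀ i m j n, (i, m) ∈ P → (j, n) ∈ Q → ((i, j), m + n) ∈ R) {x : G₁} {y : G₂}
    (hx : x ∈ monomialSpan e₁ P) (hy : y ∈ monomialSpan e₂ Q) :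
    x ⊗ₜ[Laurent] y ∈ monomialSpan e R := by
  induction hx using Submodule.span_induction with
  | zero => simp
  | add x x' _ _ hx hx' => rw [TensorProduct.add_tmul]; exact add_mem hx hx'
  | smul c x _ hx => rw [complex_smul_tmul]; exact Submodule.smul_mem _ c hx
  | mem x hx =>
    obtain ⟨⟨i, m⟩, him, rfl⟩ := hx
    induction hy using Submodule.span_induction with
    | zero => simp
    | add y y' _ _ hy hy' => rw [TensorProduct.tmul_add]; exact add_mem hy hy'
    | smul c y _ hy => rw [tmul_complex_smul]; exact Submodule.smul_mem _ c hy
    | mem y hy =>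
      obtain ⟨⟨j, n⟩, hjn, rfl⟩ := hy
      rw [T_smul_tmul_T_smul, ← he]
      exact T_smul_mem_monomialSpan e (h i m j n him hjn)

theorem Connection.tensor_d_tmul (D₁ : Connection G₁) (D₂ : Connection G₂) (x : G₁) (y : G₂) :
    (D₁.tensor D₂).d (x ⊗ₜ[Laurent] y) = D₁.d x ⊗ₜ[Laurent] y + x ⊗ₜ[Laurent] D₂.d y := rfl

theorem Connection.tensor_tauD_tmul (D₁ : Connection G₁) (D₂ : Connection G₂) (x : G₁)
    (y : G₂) : (D₁.tensor D₂).tauD (x ⊗ₜ[Laurent] y) =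
      D₁.tauD x ⊗ₜ[Laurent] y + x ⊗ₜ[Laurent] D₂.tauD y := by
  rw [Connection.tauD_apply, Connection.tensor_d_tmul, smul_add, TensorProduct.smul_tmul',
    ← TensorProduct.tmul_smul]
  rfl

theorem Connection.tensor_tauD_add_tmul (D₁ : Connection G₁) (D₂ : Connection G₂) (β₁ β₂ : ℚ)
    (x : G₁) (y : G₂) :
    ((D₁.tensor D₂).tauD + ((β₁ + β₂ : ℚ) : ℂ) • LinearMap.id : Module.End ℂ _)
        (x ⊗ₜ[Laurent] y) =
      (D₁.tauD + (β₁ : ℂ) • LinearMap.id : Module.End ℂ G₁) x ⊗ₜ[Laurent] y +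
        x ⊗ₜ[Laurent] (D₂.tauD + (β₂ : ℂ) • LinearMap.id : Module.End ℂ G₂) y := by
  simp only [LinearMap.add_apply, LinearMap.smul_apply, LinearMap.id_apply,
    Connection.tensor_tauD_tmul, TensorProduct.add_tmul, TensorProduct.tmul_add, complex_smul_tmul,
    tmul_complex_smul, Rat.cast_add, add_smul]
  abel

theorem tauD_add_smul_mem {G : Type*} [AddCommGroup G] [Module ℂ G] [Module Laurent G]
    [IsScalarTower ℂ Laurent G] {D : Connection G} {W : Submodule PolyTau G}
    (hW : ∀ g ∈ W, D.tauD g ∈ W) (c : ℂ) {g : G} (hg : g ∈ W) :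
    (D.tauD + c • LinearMap.id : Module.End ℂ G) g ∈ W :=
  add_mem (hW g hg) (complex_smul_mem_of_subalgebra W c hg)

theorem tauD_add_smul_pow_mem {G : Type*} [AddCommGroup G] [Module ℂ G] [Module Laurent G]
    [IsScalarTower ℂ Laurent G] {D : Connection G} {W : Submodule PolyTau G}
    (hW : ∀ g ∈ W, D.tauD g ∈ W) (c : ℂ) (n : ℕ) {g : G} (hg : g ∈ W) :
    ((D.tauD + c • LinearMap.id : Module.End ℂ G) ^ n) g ∈ W := by
  induction n with
  | zero => exact hg
  | succ n ih =>
    rw [pow_succ', Module.End.mul_apply]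
    exact tauD_add_smul_mem hW c ih

theorem tauD_mem_VLt {G : Type*} [AddCommGroup G] [Module ℂ G] [Module Laurent G]
    [IsScalarTower ℂ Laurent G] {D : Connection G} {V : ℚ → Submodule PolyTau G}
    (mono : Monotone V) (hV : ∀ β, ∀ g ∈ V β, D.tauD g ∈ V β) (β : ℚ) :
    ∀ g ∈ VLt V β, D.tauD g ∈ VLt V β := by
  intro g hg
  obtain ⟨γ, h, h'⟩ := (mem_VLt mono).1 hg
  exact (mem_VLt mono).2 ⟨γ, h, hV γ g h'⟩

/-- If the tensor products of elements of order `β₁` and `β₂` have order `β₁ + β₂`, then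
nilpotency on the graded pieces passes to tensor products. -/
theorem tauD_add_smul_pow_tmul_mem_VLt {D₁ : Connection G₁} {D₂ : Connection G₂}
    {V₁ : ℚ → Submodule PolyTau G₁} {V₂ : ℚ → Submodule PolyTau G₂}
    {W : ℚ → Submodule PolyTau (G₁ ⊗[Laurent] G₂)}
    (hV₁ : D₁.IsLogFiltration V₁) (hV₂ : D₂.IsLogFiltration V₂) (mono : Monotone W)
    (hW : ∀ β, ∀ g ∈ W β, (D₁.tensor D₂).tauD g ∈ W β)
    (tmul_mem : ∀ β₁ β₂ x y, x ∈ V₁ β₁ → y ∈ V₂ β₂ → x ⊗ₜ[Laurent] y ∈ W (β₁ + β₂))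
    (β₁ β₂ : ℚ) (k n₁ n₂ : ℕ) (hk : n₁ + n₂ ≤ k) (x : G₁) (y : G₂) (hx : x ∈ V₁ β₁) (hy : y ∈ V₂ β₂)
    (hx' : ((D₁.tauD + (β₁ : ℂ) • LinearMap.id : Module.End ℂ G₁) ^ n₁) x ∈ VLt V₁ β₁)
    (hy' : ((D₂.tauD + (β₂ : ℂ) • LinearMap.id : Module.End ℂ G₂) ^ n₂) y ∈ VLt V₂ β₂) :
    (((D₁.tensor D₂).tauD + ((β₁ + β₂ : ℚ) : ℂ) • LinearMap.id : Module.End ℂ _) ^ k)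
      (x ⊗ₜ[Laurent] y) ∈ VLt W (β₁ + β₂) := by
  have hstab := tauD_mem_VLt mono hW (β₁ + β₂)
  induction k generalizing n₁ n₂ x y with
  | zero =>
    obtain rfl : n₁ = 0 := by omega
    obtain ⟨γ, h1, h2⟩ := (mem_VLt hV₁.mono).1 hx'
    exact (mem_VLt mono).2 ⟨γ + β₂, by linarith, tmul_mem _ _ _ _ h2 hy⟩
  | succ k ih =>
    rcases n₁ with _ | n₁
    · refine tauD_add_smul_pow_mem hstab _ _ ?_
      obtain ⟨γ, h1, h2⟩ := (mem_VLt hV₁.mono).1 hx'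
      exact (mem_VLt mono).2 ⟨γ + β₂, by linarith, tmul_mem _ _ _ _ h2 hy⟩
    rcases n₂ with _ | n₂
    · refine tauD_add_smul_pow_mem hstab _ _ ?_
      obtain ⟨γ, h1, h2⟩ := (mem_VLt hV₂.mono).1 hy'
      exact (mem_VLt mono).2 ⟨β₁ + γ, by linarith, tmul_mem _ _ _ _ hx h2⟩
    -- By the Leibniz rule each application lowers `n₁` or `n₂` by one in each of the two terms.
    -- Once one of them is `0`, that factor is already in the smaller step of its filtration.
    rw [pow_succ, Module.End.mul_apply, Connection.tensor_tauD_add_tmul, map_add]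
    refine add_mem
      (ih n₁ (n₂ + 1) (by omega) _ _ (tauD_add_smul_mem (hV₁.tauD_mem _) _ hx) hy ?_ hy')
      (ih (n₁ + 1) n₂ (by omega) _ _ hx (tauD_add_smul_mem (hV₂.tauD_mem _) _ hy) hx' ?_)
    · rw [pow_succ, Module.End.mul_apply] at hx'
      exact hx'
    · rw [pow_succ, Module.End.mul_apply] at hy'
      exact hy'

variable {D₁ : Connection G₁} {D₂ : Connection G₂}
  {V₁ : ℚ → Submodule PolyTau G₁} {V₂ : ℚ → Submodule PolyTau G₂}
  {L₁ : Submodule PolyTheta G₁} {L₂ : Submodule PolyTheta G₂}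
  {e₁ : Module.Basis ι₁ Laurent G₁} {e₂ : Module.Basis ι₂ Laurent G₂} {a₁ : ι₁ → ℚ} {a₂ : ι₂ → ℚ}

/-- The basis `eᵢ ⊗ eⱼ`. -/
noncomputable def tensorBasis (e₁ : Module.Basis ι₁ Laurent G₁) (e₂ : Module.Basis ι₂ Laurent G₂) :
    Module.Basis (ι₁ × ι₂) Laurent (G₁ ⊗[Laurent] G₂) :=
  e₁.tensorProduct e₂

theorem tensorBasis_apply (e₁ : Module.Basis ι₁ Laurent G₁) (e₂ : Module.Basis ι₂ Laurent G₂)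
    (i : ι₁) (j : ι₂) : tensorBasis e₁ e₂ (i, j) = e₁ i ⊗ₜ[Laurent] e₂ j :=
  Module.Basis.tensorProduct_apply e₁ e₂ i j

theorem isSplitBy_tensor (h₁ : IsSplitBy V₁ L₁ e₁ a₁) (h₂ : IsSplitBy V₂ L₂ e₂ a₂) :
    IsSplitBy (monomialFiltration (tensorBasis e₁ e₂) fun p => a₁ p.1 + a₂ p.2)
      (tensorLattice L₁ L₂) (tensorBasis e₁ e₂) fun p => a₁ p.1 + a₂ p.2 where
  mem_filtration _ _ := Iff.rfl
  mem_lattice := by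
    intro g
    constructor
    · intro hg
      have hst : ∀ g ∈ monomialSpan (tensorBasis e₁ e₂) {p | p.2 ≤ 0},
          theta • g ∈ monomialSpan (tensorBasis e₁ e₂) {p | p.2 ≤ 0} := fun g hg =>
        T_smul_mem_monomialSpan_of_mem (fun i m (hm : m ≤ 0) => show -1 + m ≤ 0 by omega) hg
      have : tensorLattice L₁ L₂ ≤ adjoinSubmodule _ hst := by
        refine Submodule.span_le.2 ?_
        rintro _ ⟨x, hx, y, hy, rfl⟩
        exact tmul_mem_monomialSpan (tensorBasis_apply e₁ e₂)
          (fun i m j n (hm : m ≤ 0) (hn : n ≤ 0) => show m + n ≤ 0 by omega)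
          ((h₁.mem_lattice x).1 hx) ((h₂.mem_lattice y).1 hy)
      exact this hg
    · intro hg
      have : monomialSpan (tensorBasis e₁ e₂) {p | p.2 ≤ 0} ≤
          (tensorLattice L₁ L₂).restrictScalars ℂ := by
        refine monomialSpan_le.2 fun p m (hm : m ≤ 0) => ?_
        rw [tensorBasis_apply]
        refine T_smul_mem_of_polyTheta _ hm (Submodule.subset_span ⟨e₁ p.1, ?_, e₂ p.2, ?_, rfl⟩)
        · have := T_smul_mem_monomialSpan e₁ (P := {p | p.2 ≤ 0}) (i := p.1) (m := 0) (by simp)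
          rw [T_zero, one_smul] at this
          exact (h₁.mem_lattice _).2 this
        · have := T_smul_mem_monomialSpan e₂ (P := {p | p.2 ≤ 0}) (i := p.2) (m := 0) (by simp)
          rw [T_zero, one_smul] at this
          exact (h₂.mem_lattice _).2 this
      exact this hg

/-- The filtration is defined by the basis, so translation by `τ`, exhaustiveness and finite type
are immediate. What involves the connection is checked on monomials, which are tensor products of
elements of known order. -/
theorem Connection.IsLogFiltration.tensor [Fintype ι₁] [Fintype ι₂] (hV₁ : D₁.IsLogFiltration V₁)
    (hV₂ : D₂.IsLogFiltration V₂) (h₁ : IsSplitBy V₁ L₁ e₁ a₁) (h₂ : IsSplitBy V₂ L₂ e₂ a₂) :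
    (D₁.tensor D₂).IsLogFiltration
      (monomialFiltration (tensorBasis e₁ e₂) fun p => a₁ p.1 + a₂ p.2) := by
  set e := tensorBasis e₁ e₂
  set a : ι₁ × ι₂ → ℚ := fun p => a₁ p.1 + a₂ p.2
  have tmul_mem : ∀ β₁ β₂ x y, x ∈ V₁ β₁ → y ∈ V₂ β₂ →
      x ⊗ₜ[Laurent] y ∈ monomialFiltration e a (β₁ + β₂) := fun β₁ β₂ x y hx hy =>
    tmul_mem_monomialSpan (tensorBasis_apply e₁ e₂)
      (fun i m j n (hm : a₁ i - m ≤ β₁) (hn : a₂ j - n ≤ β₂) =>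
        show a₁ i + a₂ j - ((m + n : ℤ) : ℚ) ≤ β₁ + β₂ by push_cast; linarith)
      ((h₁.mem_filtration β₁ x).1 hx) ((h₂.mem_filtration β₂ y).1 hy)
  have mem₁ : ∀ i (m : ℤ), (T m : Laurent) • e₁ i ∈ V₁ (a₁ i - m) := fun i m =>
    (h₁.mem_filtration _ _).2 (T_smul_mem_monomialSpan e₁ (le_refl (a₁ i - m)))
  have mem₂ : ∀ j, e₂ j ∈ V₂ (a₂ j) := fun j => by
    have := T_smul_mem_monomialSpan e₂ (P := {p | a₂ p.1 - p.2 ≤ a₂ j}) (i := j) (m := 0) (by simp)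
    rw [T_zero, one_smul] at this
    exact (h₂.mem_filtration _ _).2 this
  have heq : ∀ (p : ι₁ × ι₂) (m : ℤ), (T m : Laurent) • e p =
      ((T m : Laurent) • e₁ p.1) ⊗ₜ[Laurent] e₂ p.2 := fun p m => by
    rw [← TensorProduct.smul_tmul', ← tensorBasis_apply]
  have mono := monomialFiltration_mono e a
  have tauD_mem : ∀ β, ∀ g ∈ monomialFiltration e a β,
      (D₁.tensor D₂).tauD g ∈ monomialFiltration e a β := by
    intro β g hg
    have : monomialSpan e {p | a p.1 - p.2 ≤ β} ≤
        ((monomialFiltration e a β).restrictScalars ℂ).comap (D₁.tensor D₂).tauD := by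
      refine monomialSpan_le.2 fun p m (hm : a₁ p.1 + a₂ p.2 - m ≤ β) => ?_
      rw [Submodule.mem_comap, heq, Connection.tensor_tauD_tmul]
      have hle : a₁ p.1 - m + a₂ p.2 ≤ β := by linarith
      exact add_mem (mono hle (tmul_mem _ _ _ _ (hV₁.tauD_mem _ _ (mem₁ _ _)) (mem₂ _)))
        (mono hle (tmul_mem _ _ _ _ (mem₁ _ _) (hV₂.tauD_mem _ _ (mem₂ _))))
    exact this hg
  refine ⟨mono, monomialFiltration_floor e a, exists_mem_monomialFiltration e a, fun β g => ?_,
    tauD_mem, monomialFiltration_fg e a 0, fun β => ?_⟩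
  · refine ⟨fun h => ?_, fun h => by simpa [tau] using T_smul_mem_monomialFiltration 1 h⟩
    have := T_smul_mem_monomialFiltration (-1) h
    rw [tau, T_neg_smul_T_smul] at this
    simpa using this
  · choose n₁ hn₁ using hV₁.nilpotent
    choose n₂ hn₂ using hV₂.nilpotent
    -- In `τᵐ(eᵢ ⊗ eⱼ) = τᵐeᵢ ⊗ eⱼ` of order exactly `β`, the first factor has order `β - a₂ j`,
    -- independent of `i` and `m`. Finitely many exponents therefore suffice.
    obtain ⟨k, hk⟩ := (Finset.univ.image fun j => n₁ (β - a₂ j) + n₂ (a₂ j)).bddAbove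
    refine ⟨k, fun g hg => ?_⟩
    have : monomialSpan e {p | a p.1 - p.2 ≤ β} ≤
        ((VLt (monomialFiltration e a) β).restrictScalars ℂ).comap
          (((D₁.tensor D₂).tauD + (β : ℂ) • LinearMap.id : Module.End ℂ _) ^ k) := by
      refine monomialSpan_le.2 fun p m hm => ?_
      rw [Submodule.mem_comap]
      rcases lt_or_eq_of_le (show a p - m ≤ β from hm) with hlt | heqβ
      · exact tauD_add_smul_pow_mem (tauD_mem_VLt mono tauD_mem β) _ _
          ((mem_VLt mono).2 ⟨_, hlt, T_smul_mem_monomialSpan e (le_refl (a p - m))⟩)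
      · have hβ : a₁ p.1 - m = β - a₂ p.2 := by
          have : a₁ p.1 + a₂ p.2 - m = β := heqβ
          linarith
        have hx := mem₁ p.1 m
        rw [hβ] at hx
        have := tauD_add_smul_pow_tmul_mem_VLt hV₁ hV₂ mono tauD_mem tmul_mem (β - a₂ p.2) (a₂ p.2) k
          _ _ (hk (Finset.mem_coe.2 (Finset.mem_image_of_mem _ (Finset.mem_univ p.2)))) _ _ hx
          (mem₂ p.2) (hn₁ _ _ hx) (hn₂ _ _ (mem₂ p.2))
        rw [sub_add_cancel, ← heq] at this
        exact this
    exact this hg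

/-- Since `dθ/dτ = -θ²`. This is what makes stability under `t` testable on generators over `ℂ[θ]`.
-/
theorem ddtau_mem_polyTheta {f : Laurent} (hf : f ∈ PolyTheta) : ddtau f ∈ PolyTheta := by
  induction hf using Algebra.adjoin_induction with
  | mem x hx =>
    rw [Set.mem_singleton_iff.1 hx, theta, ddtau_T]
    exact PolyTheta.smul_mem (T_mem_polyTheta 2) _
  | algebraMap r =>
    rw [Algebra.algebraMap_eq_smul_one, map_smul, ← T_zero, ddtau_T]
    simp
  | add x y _ _ hx hy => rw [map_add]; exact add_mem hx hy
  | mul x y hx' hy' hx hy =>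
    rw [ddtau_mul]
    exact add_mem (mul_mem hx hy') (mul_mem hx' hy)

theorem Connection.IsLattice.tensor (hL₁ : D₁.IsLattice L₁) (hL₂ : D₂.IsLattice L₂)
    (h₁ : IsSplitBy V₁ L₁ e₁ a₁) (h₂ : IsSplitBy V₂ L₂ e₂ a₂) :
    (D₁.tensor D₂).IsLattice (tensorLattice L₁ L₂) := by
  have h := isSplitBy_tensor h₁ h₂
  have hmem : ∀ p, tensorBasis e₁ e₂ p ∈ tensorLattice L₁ L₂ := fun p => by
    have := T_smul_mem_monomialSpan (tensorBasis e₁ e₂) (P := {p | p.2 ≤ 0}) (i := p) (m := 0)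
      (by simp)
    rw [T_zero, one_smul] at this
    exact (h.mem_lattice _).2 this
  refine ⟨?_, ?_, fun g hg => ?_⟩
  · have hspan : Submodule.span PolyTheta (Set.range (tensorBasis e₁ e₂)) =
        tensorLattice L₁ L₂ := by
      apply le_antisymm
      · rw [Submodule.span_le]
        rintro _ ⟨p, rfl⟩
        exact hmem p
      · intro g hg
        have hle : monomialSpan (tensorBasis e₁ e₂) {p | p.2 ≤ 0} ≤ (Submodule.span PolyTheta
            (Set.range (tensorBasis e₁ e₂))).restrictScalars ℂ :=
          monomialSpan_le.2 fun p m hm => T_smul_mem_of_polyTheta _ hm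
            (Submodule.subset_span (Set.mem_range_self p))
        exact hle ((h.mem_lattice g).1 hg)
    have hli : LinearIndependent PolyTheta (tensorBasis e₁ e₂) :=
      (tensorBasis e₁ e₂).linearIndependent.restrict_scalars' PolyTheta
    have := Module.Free.of_basis (Module.Basis.span hli)
    rwa [hspan] at this
  · rw [eq_top_iff, ← (tensorBasis e₁ e₂).span_eq, Submodule.span_le]
    rintro _ ⟨p, rfl⟩
    exact Submodule.subset_span (hmem p)
  · change -((D₁.tensor D₂).d g) ∈ tensorLattice L₁ L₂
    refine neg_mem ?_
    have hd₁ : ∀ x ∈ L₁, D₁.d x ∈ L₁ := fun x hx => neg_mem_iff.1 (hL₁.t_mem x hx)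
    have hd₂ : ∀ x ∈ L₂, D₂.d x ∈ L₂ := fun x hx => neg_mem_iff.1 (hL₂.t_mem x hx)
    induction hg using Submodule.span_induction with
    | mem g hg =>
      obtain ⟨x, hx, y, hy, rfl⟩ := hg
      rw [Connection.tensor_d_tmul]
      exact add_mem (Submodule.subset_span ⟨_, hd₁ x hx, y, hy, rfl⟩)
        (Submodule.subset_span ⟨x, hx, _, hd₂ y hy, rfl⟩)
    | zero => rw [map_zero]; exact zero_mem _
    | add x y _ _ hx hy => rw [map_add]; exact add_mem hx hy
    | smul f x hx' hx =>
      change (D₁.tensor D₂).d ((f : Laurent) • x) ∈ _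
      rw [(D₁.tensor D₂).leibniz]
      exact add_mem ((tensorLattice L₁ L₂).smul_mem ⟨_, ddtau_mem_polyTheta f.2⟩ hx')
        ((tensorLattice L₁ L₂).smul_mem f hx)

end Tensor

/-! ### Counting pairs of weights, and the conclusion -/

theorem card_filter_add_eq_finsum {ι₁ ι₂ : Type*} [Fintype ι₁] [Fintype ι₂] (a₁ : ι₁ → ℚ)
    (a₂ : ι₂ → ℚ) (β : ℚ) :
    (Function.support fun β' : ℚ => (Finset.univ.filter fun i => a₁ i = β').card *
      (Finset.univ.filter fun j => a₂ j = β - β').card).Finite ∧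
    (Finset.univ.filter fun p : ι₁ × ι₂ => a₁ p.1 + a₂ p.2 = β).card =
      ∑ᶠ β' : ℚ, (Finset.univ.filter fun i => a₁ i = β').card *
        (Finset.univ.filter fun j => a₂ j = β - β').card := by
  have hsub : (Function.support fun β' : ℚ => (Finset.univ.filter fun i => a₁ i = β').card *
      (Finset.univ.filter fun j => a₂ j = β - β').card) ⊆ (Finset.univ.image a₁ : Finset ℚ) := by
    intro β' h
    obtain ⟨i, hi⟩ := Finset.card_ne_zero.1 (left_ne_zero_of_mul h)
    rw [← (Finset.mem_filter.1 hi).2]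
    exact Finset.mem_coe.2 (Finset.mem_image_of_mem _ (Finset.mem_univ i))
  refine ⟨(Finset.finite_toSet _).subset hsub, ?_⟩
  -- Sort the pairs by the first weight `β'`: each fibre is the product of the indices of weight
  -- `β'` and those of weight `β - β'`.
  rw [finsum_eq_sum_of_support_subset _ hsub, Finset.card_eq_sum_card_fiberwise
    (f := fun p : ι₁ × ι₂ => a₁ p.1) (t := Finset.univ.image a₁)
    (fun p _ => Finset.mem_coe.2 (Finset.mem_image_of_mem _ (Finset.mem_univ p.1)))]
  refine Finset.sum_congr rfl fun β' _ => ?_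
  rw [← Finset.card_product]
  congr 1
  ext p
  simp only [Finset.mem_filter, Finset.mem_univ, true_and, Finset.mem_product]
  constructor
  · rintro ⟨h1, h2⟩
    exact ⟨h2, by linarith⟩
  · rintro ⟨h1, h2⟩
    exact ⟨by linarith, h1⟩

end MeroConn

/-- The filtration `V` of each factor and its lattice are split by a common basis, with the weights
of the basis as spectrum. The tensor product of the two bases splits the tensor product, with the
sums of the weights as weights. The splitting exists for every lattice: self-duality is not used. -/
theorem mainTheorem11
    {G' : Type*} [AddCommGroup G'] [Module ℂ G'] [Module Laurent G'] [IsScalarTower ℂ Laurent G']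
    [Module.Free Laurent G'] [Module.Finite Laurent G']
    {G'' : Type*} [AddCommGroup G''] [Module ℂ G''] [Module Laurent G'']
    [IsScalarTower ℂ Laurent G''] [Module.Free Laurent G''] [Module.Finite Laurent G'']
    (D' : Connection G') (hD' : D'.IsRegularQuasiUnipotent)
    (D'' : Connection G'') (hD'' : D''.IsRegularQuasiUnipotent)
    (G'₀ : Submodule PolyTheta G') (hG'₀ : D'.IsLattice G'₀)
    (G''₀ : Submodule PolyTheta G'') (hG''₀ : D''.IsLattice G''₀)
    (w' w'' : ℤ) (hw' : D'.IsSelfDual G'₀ w') (hw'' : D''.IsSelfDual G''₀ w'') :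
    (D'.tensor D'').IsRegularQuasiUnipotent ∧
    (D'.tensor D'').IsLattice (tensorLattice G'₀ G''₀) ∧
    ∀ β : ℚ,
      (Function.support fun β' : ℚ => D'.nu G'₀ β' * D''.nu G''₀ (β - β')).Finite ∧
      (D'.tensor D'').nu (tensorLattice G'₀ G''₀) β =
        ∑ᶠ β' : ℚ, D'.nu G'₀ β' * D''.nu G''₀ (β - β') := by
  obtain ⟨V', hV'⟩ := hD'.exists_isLogFiltration
  obtain ⟨V'', hV''⟩ := hD''.exists_isLogFiltration
  obtain ⟨r', e', a', h'⟩ := hV'.exists_isSplitBy hG'₀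
  obtain ⟨r'', e'', a'', h''⟩ := hV''.exists_isSplitBy hG''₀
  have hV := hV'.tensor hV'' h' h''
  refine ⟨hV.isRegularQuasiUnipotent, hG'₀.tensor hG''₀ h' h'', fun β => ?_⟩
  simp only [h'.nu_eq hV', h''.nu_eq hV'', (isSplitBy_tensor h' h'').nu_eq hV]
  exact card_filter_add_eq_finsum a' a'' β
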